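/- Let $q\in\mathbb C$ with $0<|q|<1$. Put $(a;q)_n=\prod_{j=0}^{n-1}(1-aq^j)$, $(a;q)_\infty=\prod_{j\ge0}(1-aq^j)$, $\Omega_q=\{q^{-k}:k=0,1,2,\dots\}$; a list of parameters in the first slot means the product over the list, and for ${\bf a}=(a_1,\dots,a_A)$ we write $x{\bf a}=(xa_1,\dots,xa_A)$, $x/{\bf a}=(x/a_1,\dots,x/a_A)$, ${\bf a}/x=(a_1/x,\dots,a_A/x)$ and ${\bf a}_{[k]}$ for ${\bf a}$ with $a_k$ omitted. Let $${}_{r+1}\phi_s\left({a_1,\dots,a_{r+1}\atop b_1,\dots,b_s};q,z\right)=\sum_{n\ge0}\frac{(a_1,\dots,a_{r+1};q)_n}{(q,b_1,\dots,b_s;q)_n}\left((-1)^nq^{\binom n2}\right)^{s-r}z^n ,$$ and, for $p\in\mathbb Z$, let ${}_{r+1}\phi_s^{p}$ denote the same series after adjoining $|p|$ zeros to the upper parameters if $p<0$, respectively $p$ zeros to the lower parameters if $p>0$ (van de Bult–Rains notation). Let $m\in\mathbb Z$, $t\in\mathbb C\setminus\{0\}$, $\sigma>0$, and let ${\bf a}=(a_1,\dots,a_A)$,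 ${\bf b}=(b_1,\dots,b_B)$, ${\bf c}=(c_1,\dots,c_C)$, ${\bf d}=(d_1,\dots,d_D)$ be finite (possibly empty) lists of complex numbers with $|c_k|<\sigma/|t|$ and $|d_l|<1/\sigma$ for all $k,l$ (so that $|tc_kd_l|<1$). With $z=e^{i\psi}$ and $\sqrt t$ the principal root, $t^{m/2}=(\sqrt t)^m$, define $$G_{m,t}({\bf a},{\bf b},{\bf c},{\bf d};\sigma,q)=\frac{(q;q)_\infty}{2\pi}\left(\frac{\sqrt t}{\sigma}\right)^m\int_{-\pi}^{\pi}\frac{({\bf b}\frac{\sigma}{z},t{\bf a}\frac z\sigma;q)_\infty}{({\bf d}\frac\sigma z,t{\bf c}\frac z\sigma;q)_\infty}e^{im\psi}\,d\psi .$$ Then the integral exists, and the following hold. (i) If $|c_k|,|d_l|<\min\{1/\sigma,\sigma/|t|\}$ for all $k,l$, then $G_{m,t}({\bf a},{\bf b},{\bf c},{\bf d};\sigma,q)=G_{-m,t}({\bf b},{\bf a},{\bf d},{\bf c};\sigma,q)$. (ii) Suppose that all $d_l$ and all $b_j$ are nonzero, that $td_ka_i\notin\Omega_q$ for all $k,i$,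 and that $d_l/d_{l'}\notin\Omega_q$ for $l\ne l'$. If $D>B$, or if $D=B$ and $|q^mb_1\cdots b_B|<|d_1\cdots d_D|$, then $$G_{m,t}({\bf a},{\bf b},{\bf c},{\bf d};\sigma,q)=t^{m/2}\sum_{k=1}^D\frac{(td_k{\bf a},{\bf b}/d_k;q)_\infty\,d_k^m}{(td_k{\bf c},{\bf d}_{[k]}/d_k;q)_\infty}\;{}_{B+C}\phi_{A+D-1}^{\,C-A}\left({td_k{\bf c},\,qd_k/{\bf b}\atop td_k{\bf a},\,qd_k/{\bf d}_{[k]}};q,\;q^m(qd_k)^{D-B}\frac{b_1\cdots b_B}{d_1\cdots d_D}\right).$$ Moreover, for every $k$: if $D>B$, the series, for an arbitrary argument, converges absolutely and is an entire function of the argument; if $D=B$ and $|q^mb_1\cdots b_B|<|d_1\cdots d_D|$, the series in the formula converges absolutely; in the remaining cases ($D<B$, or $D=B$ and $|q^mb_1\cdots b_B|\ge|d_1\cdots d_D|$) it diverges whenever it is nonterminating, that is, whenever none of its upper parameters lies in $\Omega_q$. (iii) Suppose that all $c_k$ and all $a_i$ are nonzero, that $tc_kb_j\notin\Omega_q$ for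 all $k,j$, and that $c_k/c_{k'}\notin\Omega_q$ for $k\ne k'$. If $C>A$, or if $C=A$ and $|q^{-m}a_1\cdots a_A|<|c_1\cdots c_C|$, then $$G_{m,t}({\bf a},{\bf b},{\bf c},{\bf d};\sigma,q)=\frac1{t^{m/2}}\sum_{k=1}^C\frac{(tc_k{\bf b},{\bf a}/c_k;q)_\infty\,c_k^{-m}}{(tc_k{\bf d},{\bf c}_{[k]}/c_k;q)_\infty}\;{}_{A+D}\phi_{B+C-1}^{\,D-B}\left({tc_k{\bf d},\,qc_k/{\bf a}\atop tc_k{\bf b},\,qc_k/{\bf c}_{[k]}};q,\;q^{-m}(qc_k)^{C-A}\frac{a_1\cdots a_A}{c_1\cdots c_C}\right).$$ Moreover, for every $k$: if $C>A$, the series, for an arbitrary argument, converges absolutely and is an entire function of the argument; if $C=A$ and $|q^{-m}a_1\cdots a_A|<|c_1\cdots c_C|$, the series in the formula converges absolutely; in the remaining cases ($C<A$, or $C=A$ and $|q^{-m}a_1\cdots a_A|\ge|c_1\cdots c_C|$) it diverges whenever it is nonterminating, that is, whenever none of its upper parameters lies in $\Omega_q$. -/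

import Mathlib

noncomputable section

namespace QSeries

/-- The set `Ω_q = {q⁻ᵏ : k = 0, 1, 2, …}`. -/
def Omega (q : ℂ) : Set ℂ := {x | ∃ k : ℕ, x = (q ^ k)⁻¹}

/-- The finite `q`-shifted factorial `(a; q)_n = (1 - a)(1 - aq) ⋯ (1 - aq^(n-1))`. -/
def qPoch (a q : ℂ) (n : ℕ) : ℂ := ∏ j ∈ Finset.range n, (1 - a * q ^ j)

/-- The infinite `q`-shifted factorial `(a; q)_∞`; the product converges for `‖q‖ < 1`. -/
def qPochInf (a q : ℂ) : ℂ := ∏' j : ℕ, (1 - a * q ^ j)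

/-- The product `(f₁, …, fₙ; q)_∞`. -/
def qPochInfs {n : ℕ} (f : Fin n → ℂ) (q : ℂ) : ℂ := ∏ i, qPochInf (f i) q

/-- The `n`-th term of the basic hypergeometric series `_{r+1}φ_s`, where `r + 1` and `s` are the
numbers of entries (with multiplicity) of `top` and `bot`. -/
def phiTerm (top bot : Multiset ℂ) (q z : ℂ) (n : ℕ) : ℂ :=
  (top.map fun x => qPoch x q n).prod / (qPoch q q n * (bot.map fun x => qPoch x q n).prod) *
    ((-1) ^ n * q ^ n.choose 2) ^ ((bot.card : ℤ) + 1 - (top.card : ℤ)) * z ^ n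

/-- The `n`-th term of the van de Bult–Rains series `_{r+1}φ_s^p`: for `p < 0` the upper
parameters, for `p > 0` the lower parameters are supplemented by `|p|` zeros. -/
def vdBRTerm (p : ℤ) (top bot : Multiset ℂ) (q z : ℂ) (n : ℕ) : ℂ :=
  phiTerm (top + Multiset.replicate (-p).toNat 0) (bot + Multiset.replicate p.toNat 0) q z n

/-- The van de Bult–Rains series `_{r+1}φ_s^p (top; bot; q, z)`. -/
def vdBR (p : ℤ) (top bot : Multiset ℂ) (q z : ℂ) : ℂ := ∑' n, vdBRTerm p top bot q z n

section

variable {A B C D : ℕ}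

/-- The integrand `(b σ/z, t a z/σ; q)_∞ / (d σ/z, t c z/σ; q)_∞ · e^{imψ}` with `z = e^{iψ}`. -/
def integrand (m : ℤ) (t : ℂ) (a : Fin A → ℂ) (b : Fin B → ℂ) (c : Fin C → ℂ) (d : Fin D → ℂ)
    (σ : ℝ) (q : ℂ) (ψ : ℝ) : ℂ :=
  let z : ℂ := Complex.exp (Complex.I * ψ)
  (qPochInfs (fun j => b j * (σ / z)) q * qPochInfs (fun i => t * a i * (z / σ)) q) /
    (qPochInfs (fun l => d l * (σ / z)) q * qPochInfs (fun k => t * c k * (z / σ)) q) *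
    Complex.exp (Complex.I * m * ψ)

/-- `G_{m,t}(a, b, c, d; σ, q)`, with the principal square root of `t`. -/
def G (m : ℤ) (t : ℂ) (a : Fin A → ℂ) (b : Fin B → ℂ) (c : Fin C → ℂ) (d : Fin D → ℂ)
    (σ : ℝ) (q : ℂ) : ℂ :=
  qPochInf q q / (2 * Real.pi) * (Complex.sqrt t / σ) ^ m *
    ∫ ψ in (-Real.pi)..Real.pi, integrand m t a b c d σ q ψ

/-- The coefficient
`(t d_k a, b / d_k; q)_∞ d_k^m / (t d_k c, d_[k] / d_k; q)_∞`, where `d_[k]` omits `d_k`. -/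
def coeff (m : ℤ) (t : ℂ) (a : Fin A → ℂ) (b : Fin B → ℂ) (c : Fin C → ℂ) (d : Fin D → ℂ)
    (q : ℂ) (k : Fin D) : ℂ :=
  qPochInfs (fun i => t * d k * a i) q * qPochInfs (fun j => b j / d k) q * d k ^ m /
    (qPochInfs (fun i => t * d k * c i) q *
      ∏ l ∈ Finset.univ.erase k, qPochInf (d l / d k) q)

/-- The upper parameters `t d_k c, q d_k / b`. -/
def topPar (t : ℂ) (b : Fin B → ℂ) (c : Fin C → ℂ) (d : Fin D → ℂ) (q : ℂ) (k : Fin D) :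
    Multiset ℂ :=
  Finset.univ.val.map (fun i => t * d k * c i) + Finset.univ.val.map (fun j => q * d k / b j)

/-- The lower parameters `t d_k a, q d_k / d_[k]`, where `d_[k]` omits `d_k`. -/
def botPar (t : ℂ) (a : Fin A → ℂ) (d : Fin D → ℂ) (q : ℂ) (k : Fin D) : Multiset ℂ :=
  Finset.univ.val.map (fun i => t * d k * a i) +
    (Finset.univ.erase k).val.map (fun l => q * d k / d l)

/-- The argument `q^m (q d_k)^(D-B) b₁⋯b_B / (d₁⋯d_D)`. -/
def arg (m : ℤ) (b : Fin B → ℂ) (d : Fin D → ℂ) (q : ℂ) (k : Fin D) : ℂ :=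
  q ^ m * (q * d k) ^ ((D : ℤ) - B) * ((∏ j, b j) / ∏ l, d l)

end

/-- The series with terms `u 0, u 1, …` diverges: its partial sums have no limit. -/
def SeriesDiverges (u : ℕ → ℂ) : Prop :=
  ¬ ∃ s : ℂ, Filter.Tendsto (fun N => ∑ n ∈ Finset.range N, u n) Filter.atTop (nhds s)

end QSeries

end

open Filter Topology

/-! ### The `q`-shifted factorials -/

namespace QSeries

variable {q : ℂ}

/-! With `w = z/σ` the integrand becomes a kernel free of `σ`, which survives only as the radius
`1/σ` of the contour (`G_eq`). Away from `0` the kernel can have poles only at `d_l q^n`, inside the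
circle, and at `1/(t c_k q^n)`, outside it. The map `w ↦ 1/(t w)` swaps the two families and sends
`σ` to `|t|/σ` (`G_eq_G_neg`). Under the bounds in (i), Cauchy's theorem moves the contour back to
the original radius.

Formula (ii) is a residue sum over the points `d_k q^n`. Since `(x;q)_∞ = (1-x)(xq;q)_∞`, passing
from `w` to `q w` multiplies the kernel by a rational function whose value at `0` has modulus below
`1` in the stated cases (`exists_norm_kernel_mul_le`). Hence the integrals over circles of radius
`r|q|^N` tend to `0`, and only residues remain (`circleIntegral_kernel_eq_tsum`). Reversing finite
products (`qPoch_div_pow`) identifies the `n`-th residue with the `n`-th term of the series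
(`qPochInf_mul_residueKernel`). Formula (iii) is (ii) after the swap.

For convergence, each term is a convergent quotient of factorials times `gaussTerm` with exponent `D
- B`, so the latter alone decides. -/

theorem summable_mul_pow (hq : ‖q‖ < 1) (x : ℂ) : Summable fun j : ℕ => ‖-(x * q ^ j)‖ := by
  simp only [norm_neg, norm_mul, norm_pow]
  exact (summable_geometric_of_lt_one (norm_nonneg q) hq).mul_left _

theorem multipliable_qPoch (hq : ‖q‖ < 1) (x : ℂ) : Multipliable fun j : ℕ => 1 - x * q ^ j := by
  simpa only [sub_eq_add_neg] using multipliable_one_add_of_summable (summable_mul_pow hq x)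

theorem tendsto_qPoch (hq : ‖q‖ < 1) (x : ℂ) :
    Tendsto (qPoch x q) atTop (𝓝 (qPochInf x q)) :=
  (multipliable_qPoch hq x).hasProd.tendsto_prod_nat

theorem qPoch_zero_left (n : ℕ) : qPoch 0 q n = 1 := by simp [qPoch]

theorem qPoch_zero_right (x : ℂ) : qPoch x q 0 = 1 := by simp [qPoch]

theorem qPoch_succ (x : ℂ) (n : ℕ) : qPoch x q (n + 1) = qPoch x q n * (1 - x * q ^ n) :=
  Finset.prod_range_succ _ _

theorem qPoch_succ' (x : ℂ) (n : ℕ) : qPoch x q (n + 1) = (1 - x) * qPoch (x * q) q n := by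
  rw [qPoch, Finset.prod_range_succ', mul_comm, qPoch]
  simp [pow_succ', mul_assoc]

theorem qPochInf_eq_one_sub_mul (hq : ‖q‖ < 1) (x : ℂ) :
    qPochInf x q = (1 - x) * qPochInf (x * q) q := by
  refine tendsto_nhds_unique ((tendsto_qPoch hq x).comp (tendsto_add_atTop_nat 1)) ?_
  refine ((tendsto_qPoch hq (x * q)).const_mul (1 - x)).congr fun n => ?_
  simp [qPoch_succ']

theorem qPochInf_eq_qPoch_mul (hq : ‖q‖ < 1) (x : ℂ) (n : ℕ) :
    qPochInf x q = qPoch x q n * qPochInf (x * q ^ n) q := by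
  induction n with
  | zero => simp [qPoch_zero_right]
  | succ n ih =>
    rw [ih, qPoch_succ, qPochInf_eq_one_sub_mul hq (x * q ^ n), pow_succ]
    ring_nf

theorem one_sub_mul_pow_ne_zero {x : ℂ} (hx : x ∉ Omega q) (j : ℕ) :
    1 - x * q ^ j ≠ 0 := by
  intro h
  refine hx ⟨j, ?_⟩
  exact eq_inv_of_mul_eq_one_left (by linear_combination -h)

theorem qPoch_ne_zero {x : ℂ} (hx : x ∉ Omega q) (n : ℕ) : qPoch x q n ≠ 0 :=
  Finset.prod_ne_zero_iff.2 fun j _ => one_sub_mul_pow_ne_zero hx j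

theorem qPochInf_ne_zero (hq : ‖q‖ < 1) {x : ℂ} (hx : x ∉ Omega q) :
    qPochInf x q ≠ 0 := by
  have h := tprod_one_add_ne_zero_of_summable (f := fun j : ℕ => -(x * q ^ j))
    (fun j => by simpa only [← sub_eq_add_neg] using one_sub_mul_pow_ne_zero hx j)
    (summable_mul_pow hq x)
  simpa only [qPochInf, sub_eq_add_neg] using h

theorem notMem_Omega_of_norm_lt_one (hq0 : q ≠ 0) (hq : ‖q‖ < 1) {x : ℂ} (hx : ‖x‖ < 1) :
    x ∉ Omega q := by
  rintro ⟨k, rfl⟩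
  rw [norm_inv, norm_pow] at hx
  exact absurd hx (not_lt.2 ((one_le_inv₀ (pow_pos (norm_pos_iff.2 hq0) _)).2
    (pow_le_one₀ (norm_nonneg _) hq.le)))

theorem differentiable_qPochInf (hq : ‖q‖ < 1) : Differentiable ℂ fun x => qPochInf x q := by
  intro x
  have hU : IsOpen (Metric.ball (0 : ℂ) (‖x‖ + 1)) := Metric.isOpen_ball
  have hx : x ∈ Metric.ball (0 : ℂ) (‖x‖ + 1) := by simp
  have hs : Summable fun j : ℕ => (‖x‖ + 1) * ‖q‖ ^ j :=
    (summable_geometric_of_lt_one (norm_nonneg q) hq).mul_left _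
  have h := hs.hasProdLocallyUniformlyOn_nat_one_add (f := fun (j : ℕ) (y : ℂ) => -(y * q ^ j))
    hU (Eventually.of_forall fun j y hy => by
      rw [norm_neg, norm_mul, norm_pow]
      have : ‖y‖ < ‖x‖ + 1 := by simpa using hy
      gcongr) (fun j => by fun_prop)
  have h' := h.tendstoLocallyUniformlyOn_finsetRange.differentiableOn
    (Eventually.of_forall fun n => by fun_prop) hU
  simpa only [qPochInf, sub_eq_add_neg] using h'.differentiableAt (hU.mem_nhds hx)

/-- The factors on the left are `1 - x q^(-i)` for `1 ≤ i ≤ n`; pulling `-x q^(-i)` out of each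
leaves `1 - q^i/x`. -/
theorem qPoch_div_pow (hq0 : q ≠ 0) {x : ℂ} (hx : x ≠ 0) (n : ℕ) :
    qPoch (x / q ^ n) q n = (x / q) ^ n / ((-1) ^ n * q ^ n.choose 2) * qPoch (q / x) q n := by
  induction n with
  | zero => simp [qPoch_zero_right]
  | succ n ih =>
    have h : x / q ^ (n + 1) * q = x / q ^ n := by
      rw [pow_succ]
      field_simp
    rw [qPoch_succ', h, ih, qPoch_succ, Nat.choose_succ_succ', Nat.choose_one_right,
      div_pow, div_pow]
    field_simp
    ring

theorem qPochInf_div_pow (hq0 : q ≠ 0) (hq : ‖q‖ < 1) {x : ℂ} (hx : x ≠ 0) (n : ℕ) :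
    qPochInf (x / q ^ n) q =
      (x / q) ^ n / ((-1) ^ n * q ^ n.choose 2) * qPoch (q / x) q n * qPochInf x q := by
  rw [qPochInf_eq_qPoch_mul hq _ n, qPoch_div_pow hq0 hx, div_mul_cancel₀ _ (pow_ne_zero _ hq0)]

end QSeries

/-! ### Cauchy's theorem and residues on an annulus -/

open Metric in
theorem circleIntegral_eq_of_differentiableAt_annulus {r R : ℝ} (hr : 0 < r) (hrR : r ≤ R)
    {f : ℂ → ℂ} (hf : ∀ w, r ≤ ‖w‖ → ‖w‖ ≤ R → DifferentiableAt ℂ f w) :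
    (∮ w in C(0, R), f w) = ∮ w in C(0, r), f w := by
  refine Complex.circleIntegral_eq_of_differentiable_on_annulus_off_countable hr hrR
    Set.countable_empty (fun w hw => ?_) (fun w hw => ?_)
  · simp only [Set.mem_sdiff, mem_closedBall, mem_ball, dist_zero_right, not_lt] at hw
    exact (hf w hw.2 hw.1).continuousAt.continuousWithinAt
  · simp only [Set.mem_sdiff, mem_closedBall, mem_ball, dist_zero_right, not_le] at hw
    exact hf w hw.1.2.le hw.1.1.le

/-- The residue theorem for an annulus: `f` is holomorphic on `r ≤ ‖w‖ ≤ R` except for simple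
poles at finitely many interior points `p i`, where `f w = g i w / (w - p i)`. -/
theorem circleIntegral_eq_add_sum_residues {ι : Type*} {r R : ℝ} (hr : 0 < r) (hrR : r < R)
    (s : Finset ι) (p : ι → ℂ) (hp : Set.InjOn p s) (hpr : ∀ i ∈ s, r < ‖p i‖ ∧ ‖p i‖ < R)
    (g : ι → ℂ → ℂ) (hg : ∀ i ∈ s, ∀ᶠ w in 𝓝 (p i), DifferentiableAt ℂ (g i) w) (f : ℂ → ℂ)
    (hf : ∀ w, r ≤ ‖w‖ → ‖w‖ ≤ R → (∀ i ∈ s, w ≠ p i) → DifferentiableAt ℂ f w)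
    (hfg : ∀ i ∈ s, ∀ᶠ w in 𝓝[≠] (p i), f w = g i w / (w - p i)) :
    (∮ w in C(0, R), f w) =
      (∮ w in C(0, r), f w) + 2 * Real.pi * Complex.I * ∑ i ∈ s, g i (p i) := by
  classical
  induction s using Finset.induction_on generalizing f g with
  | empty =>
    simpa using circleIntegral_eq_of_differentiableAt_annulus hr hrR.le
      fun w h1 h2 => hf w h1 h2 (by simp)
  | insert k s hk ih =>
    have hks : k ∈ insert k s := Finset.mem_insert_self k s
    have hsub : ∀ i ∈ s, i ∈ insert k s := fun i hi => Finset.mem_insert_of_mem hi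
    have hne : ∀ i ∈ s, p i ≠ p k := fun i hi h =>
      hk (hp (hsub i hi) hks h ▸ hi)
    -- `u` is the residue at `p k`. Removing the principal part leaves a removable singularity,
    -- filled with its limit `deriv (g k) (p k)`; near `p k` the result is the difference quotient
    -- `dslope (g k) (p k)`.
    set u : ℂ := g k (p k) with hu
    set f' : ℂ → ℂ := Function.update (fun w => f w - u / (w - p k)) (p k) (deriv (g k) (p k))
      with hf'
    have hf'ne : ∀ w, w ≠ p k → f' w = f w - u / (w - p k) := fun w hw => by simp [hf', hw]
    have hev : ∀ w, w ≠ p k → f' =ᶠ[𝓝 w] fun w => f w - u / (w - p k) := fun w hw =>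
      (eventually_ne_nhds hw).mono hf'ne
    have hpole : ∀ w, w ≠ p k → DifferentiableAt ℂ (fun w => u / (w - p k)) w := fun w hw => by
      have := sub_ne_zero.2 hw
      fun_prop (disch := assumption)
    have hdk : DifferentiableAt ℂ f' (p k) := by
      obtain ⟨t, ht, hgt⟩ := (hg k hks).exists_mem
      have h1 : DifferentiableOn ℂ (dslope (g k) (p k)) t :=
        (Complex.differentiableOn_dslope ht).2 fun w hw => (hgt w hw).differentiableWithinAt
      refine (h1.differentiableAt ht).congr_of_eventuallyEq ?_
      have h2 := hfg k hks
      rw [eventually_nhdsWithin_iff] at h2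
      filter_upwards [h2] with w hw
      by_cases hwk : w = p k
      · simp [hf', hwk]
      · rw [hf'ne w hwk, hw hwk, dslope_of_ne _ hwk, slope_def_field, sub_div]
    -- The correction to `g i` carries the factor `w - p i`, so the residues at the remaining poles
    -- do not change.
    have hmain := ih (hp.mono (by simp)) (fun i hi => hpr i (hsub i hi))
      (fun i w => g i w - (w - p i) * (u / (w - p k)))
      (fun i hi => by
        filter_upwards [hg i (hsub i hi), eventually_ne_nhds (hne i hi)] with w h1 h2
        exact h1.sub (((differentiableAt_id).sub_const _).mul (hpole w h2))) f'
      (fun w h1 h2 h3 => by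
        by_cases hwk : w = p k
        · rw [hwk]; exact hdk
        · refine DifferentiableAt.congr_of_eventuallyEq ?_ (hev w hwk)
          refine (hf w h1 h2 fun i hi => ?_).sub (hpole w hwk)
          rcases Finset.mem_insert.1 hi with rfl | hi
          exacts [hwk, h3 i hi])
      (fun i hi => by
        filter_upwards [hfg i (hsub i hi), self_mem_nhdsWithin,
          nhdsWithin_le_nhds (eventually_ne_nhds (hne i hi))] with w h1 h2 h3
        rw [hf'ne w h3, h1, sub_div, mul_div_cancel_left₀ _ (sub_ne_zero.2 h2)])
    have hcont : ∀ ρ, 0 ≤ ρ → (∀ w, ‖w‖ = ρ → r ≤ ‖w‖ ∧ ‖w‖ ≤ R ∧ ∀ i ∈ insert k s, w ≠ p i) →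
        (∮ w in C(0, ρ), f' w) = (∮ w in C(0, ρ), f w) - u * ∮ w in C(0, ρ), (w - p k)⁻¹ := by
      intro ρ hρ h
      rw [← circleIntegral.integral_const_mul, ← circleIntegral.integral_sub]
      · refine circleIntegral.integral_congr hρ fun w hw => ?_
        rw [mem_sphere_zero_iff_norm] at hw
        rw [hf'ne w ((h w hw).2.2 k hks), div_eq_mul_inv]
      · refine ContinuousOn.circleIntegrable hρ fun w hw => ?_
        rw [mem_sphere_zero_iff_norm] at hw
        exact (hf w (h w hw).1 (h w hw).2.1 (h w hw).2.2).continuousAt.continuousWithinAt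
      · refine ContinuousOn.circleIntegrable hρ fun w hw => ?_
        rw [mem_sphere_zero_iff_norm] at hw
        simpa only [div_eq_mul_inv] using
          (hpole w ((h w hw).2.2 k hks)).continuousAt.continuousWithinAt
    -- As `r < ‖p k‖ < R`, the principal part integrates to `2πi u` over the outer circle and to `0`
    -- over the inner one.
    rw [hcont R (hr.trans hrR).le, hcont r hr.le, circleIntegral.integral_sub_inv_of_mem_ball,
      show (∮ w in C(0, r), (w - p k)⁻¹) = 0 from ?_] at hmain
    · rw [Finset.sum_insert hk]
      simp only [sub_self, zero_mul, sub_zero, mul_zero] at hmain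
      linear_combination hmain
    · refine Complex.circleIntegral_eq_zero_of_differentiable_on_off_countable hr.le
        Set.countable_empty (fun w hw => ?_) (fun w hw => ?_)
      · have : w - p k ≠ 0 := sub_ne_zero.2 fun h => by
          have h1 := (hpr k hks).1
          rw [mem_closedBall_zero_iff, h] at hw
          linarith
        exact ContinuousAt.continuousWithinAt (by fun_prop (disch := assumption))
      · have : w - p k ≠ 0 := sub_ne_zero.2 fun h => by
          have h1 := (hpr k hks).1
          have h2 := mem_ball_zero_iff.1 hw.1
          rw [h] at h2
          linarith
        fun_prop (disch := assumption)
    · simpa using (hpr k hks).2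
    · intro w hw
      refine ⟨hw.ge, hw.trans_le hrR.le, fun i hi h => ?_⟩
      have := (hpr i hi).1
      rw [← h] at this; linarith
    · intro w hw
      refine ⟨hrR.le.trans hw.ge, hw.le, fun i hi h => ?_⟩
      have := (hpr i hi).2
      rw [← h] at this; linarith

/-! ### Convergence and divergence of basic hypergeometric series -/

noncomputable section

namespace QSeries

variable {q : ℂ}

/-- The factor `((-1)ⁿ q^(n choose 2))^E zⁿ` of the terms of a basic hypergeometric series. -/
def gaussTerm (E : ℤ) (q z : ℂ) (n : ℕ) : ℂ := ((-1) ^ n * q ^ n.choose 2) ^ E * z ^ n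

theorem gaussTerm_succ (E : ℤ) (q z : ℂ) (n : ℕ) :
    gaussTerm E q z (n + 1) = gaussTerm E q z n * ((-q ^ n) ^ E * z) := by
  have h : (-1 : ℂ) ^ (n + 1) * q ^ (n + 1).choose 2 = (-1) ^ n * q ^ n.choose 2 * (-q ^ n) := by
    rw [Nat.choose_succ_succ', Nat.choose_one_right]
    ring
  rw [gaussTerm, gaussTerm, h, mul_zpow _ (-q ^ n)]
  ring

theorem norm_neg_pow_zpow_mul (E : ℤ) (q z : ℂ) (n : ℕ) :
    ‖(-q ^ n) ^ E * z‖ = (‖q‖ ^ E) ^ n * ‖z‖ := by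
  rw [norm_mul, norm_zpow, norm_neg, norm_pow, ← zpow_natCast, ← zpow_natCast, ← zpow_mul,
    ← zpow_mul, mul_comm (n : ℤ)]

/-- Ratio test: consecutive terms have ratio of modulus `(‖q‖^E)^n ‖z‖`, which tends to `0` for `E >
0` and is constantly `‖z‖` for `E = 0`. -/
theorem summable_gaussTerm (hq : ‖q‖ < 1) {E : ℤ} {z : ℂ}
    (h : 0 < E ∨ E = 0 ∧ ‖z‖ < 1) : Summable (gaussTerm E q z) := by
  obtain ⟨ρ, hρ, hle⟩ : ∃ ρ < (1 : ℝ), ∀ᶠ n in atTop, ‖(-q ^ n) ^ E * z‖ ≤ ρ := by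
    rcases h with hE | ⟨rfl, hz⟩
    · have h1 : ‖q‖ ^ E < 1 := by
        lift E to ℕ using hE.le
        rw [zpow_natCast]
        exact pow_lt_one₀ (norm_nonneg q) hq (by lia)
      have h2 := (tendsto_pow_atTop_nhds_zero_of_lt_one (by positivity) h1).mul_const ‖z‖
      rw [zero_mul] at h2
      refine ⟨1 / 2, by norm_num, ?_⟩
      filter_upwards [h2.eventually_le_const (by norm_num : (0 : ℝ) < 1 / 2)] with n hn
      rwa [norm_neg_pow_zpow_mul]
    · exact ⟨‖z‖, hz, Eventually.of_forall fun n => by simp⟩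
  refine summable_of_ratio_norm_eventually_le hρ ?_
  filter_upwards [hle] with n hn
  rw [gaussTerm_succ, norm_mul, mul_comm]
  gcongr

/-- The same ratio is eventually at least `1` in modulus, so the norms are nondecreasing from some
index `N` on and the `N`-th one serves as `ε`. -/
theorem exists_le_norm_gaussTerm (hq0 : q ≠ 0) (hq : ‖q‖ < 1) {E : ℤ} {z : ℂ} (hz : z ≠ 0)
    (h : E < 0 ∨ E = 0 ∧ 1 ≤ ‖z‖) : ∃ ε > 0, ∀ᶠ n in atTop, ε ≤ ‖gaussTerm E q z n‖ := by
  obtain ⟨N, hN⟩ : ∃ N, ∀ n ≥ N, 1 ≤ ‖(-q ^ n) ^ E * z‖ := by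
    rcases h with hE | ⟨rfl, hz⟩
    · have h1 : 1 < ‖q‖ ^ E := one_lt_zpow_of_neg₀ (norm_pos_iff.2 hq0) hq hE
      have h2 := (tendsto_pow_atTop_atTop_of_one_lt h1).atTop_mul_const (norm_pos_iff.2 hz)
      obtain ⟨N, hN⟩ := eventually_atTop.1 (h2.eventually_ge_atTop 1)
      exact ⟨N, fun n hn => by rw [norm_neg_pow_zpow_mul]; exact hN n hn⟩
    · exact ⟨0, fun n _ => by simpa using hz⟩
  refine ⟨‖gaussTerm E q z N‖, norm_pos_iff.2 ?_, eventually_atTop.2 ⟨N, fun n hn => ?_⟩⟩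
  · exact mul_ne_zero (zpow_ne_zero _ (mul_ne_zero (pow_ne_zero _ (by norm_num))
      (pow_ne_zero _ hq0))) (pow_ne_zero _ hz)
  · induction n, hn using Nat.le_induction with
    | base => exact le_rfl
    | succ n hn ih =>
      rw [gaussTerm_succ, norm_mul]
      exact ih.trans (le_mul_of_one_le_right (norm_nonneg _) (hN n hn))

/-- The quotient of `q`-shifted factorials in the terms of a basic hypergeometric series. -/
def pochRatio (top bot : Multiset ℂ) (q : ℂ) (n : ℕ) : ℂ :=
  (top.map fun x => qPoch x q n).prod / (qPoch q q n * (bot.map fun x => qPoch x q n).prod)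

/-- Since `(0;q)_n = 1`, adjoined zeros affect only the parameter count, so `p` just shifts the
exponent. -/
theorem vdBRTerm_eq (p : ℤ) (top bot : Multiset ℂ) (q z : ℂ) (n : ℕ) :
    vdBRTerm p top bot q z n =
      pochRatio top bot q n * gaussTerm ((bot.card : ℤ) + 1 - top.card + p) q z n := by
  have h : ((bot + Multiset.replicate p.toNat 0).card : ℤ) + 1 -
      ((top + Multiset.replicate (-p).toNat 0).card : ℤ) = (bot.card : ℤ) + 1 - top.card + p := by
    simp only [Multiset.card_add, Multiset.card_replicate, Nat.cast_add]
    lia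
  rw [vdBRTerm, phiTerm, h, pochRatio, gaussTerm]
  simp [qPoch_zero_left, mul_assoc]

theorem tendsto_pochRatio (hq0 : q ≠ 0) (hq : ‖q‖ < 1) (top : Multiset ℂ) {bot : Multiset ℂ}
    (hbot : ∀ y ∈ bot, y ∉ Omega q) :
    Tendsto (pochRatio top bot q) atTop (𝓝 ((top.map fun x => qPochInf x q).prod /
      (qPochInf q q * (bot.map fun x => qPochInf x q).prod))) := by
  have h (s : Multiset ℂ) : Tendsto (fun n => (s.map fun x => qPoch x q n).prod) atTop
      (𝓝 (s.map fun x => qPochInf x q).prod) :=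
    tendsto_multiset_prod s fun x _ => tendsto_qPoch hq x
  refine (h top).div ((tendsto_qPoch hq q).mul (h bot)) (mul_ne_zero ?_ ?_)
  · exact qPochInf_ne_zero hq (notMem_Omega_of_norm_lt_one hq0 hq hq)
  · refine Multiset.prod_ne_zero fun h0 => ?_
    obtain ⟨y, hy, h0⟩ := Multiset.mem_map.1 h0
    exact qPochInf_ne_zero hq (hbot y hy) h0

theorem summable_vdBRTerm (hq0 : q ≠ 0) (hq : ‖q‖ < 1) {p : ℤ} {top bot : Multiset ℂ}
    (hbot : ∀ y ∈ bot, y ∉ Omega q) {z : ℂ}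
    (h : 0 < (bot.card : ℤ) + 1 - top.card + p ∨
      (bot.card : ℤ) + 1 - top.card + p = 0 ∧ ‖z‖ < 1) :
    Summable (vdBRTerm p top bot q z) := by
  obtain ⟨K, hK⟩ := (tendsto_pochRatio hq0 hq top hbot).norm.bddAbove_range
  refine Summable.of_norm_bounded ((summable_gaussTerm hq h).norm.mul_left K) fun n => ?_
  rw [vdBRTerm_eq, norm_mul]
  gcongr
  exact hK ⟨n, rfl⟩

theorem vdBRTerm_eq_mul_pow (p : ℤ) (top bot : Multiset ℂ) (q z : ℂ) (n : ℕ) :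
    vdBRTerm p top bot q z n = vdBRTerm p top bot q 1 n * z ^ n := by
  simp [vdBRTerm, phiTerm]

theorem differentiable_vdBR {p : ℤ} {top bot : Multiset ℂ}
    (h : ∀ z, Summable (vdBRTerm p top bot q z)) :
    Differentiable ℂ fun z => vdBR p top bot q z := by
  intro x
  -- Summability at the single real point `‖x‖ + 1` majorizes the power series on the whole ball of
  -- that radius.
  refine (Complex.differentiableOn_tsum_of_summable_norm (h ((‖x‖ + 1 : ℝ) : ℂ)).norm
    (U := Metric.ball 0 (‖x‖ + 1)) (fun n => ?_) Metric.isOpen_ball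
    (fun n w hw => ?_)).differentiableAt (Metric.isOpen_ball.mem_nhds (by simp))
  · refine DifferentiableOn.congr (f := fun z => vdBRTerm p top bot q 1 n * z ^ n) (by fun_prop)
      fun z _ => vdBRTerm_eq_mul_pow p top bot q z n
  · rw [vdBRTerm_eq_mul_pow, vdBRTerm_eq_mul_pow _ _ _ _ ((‖x‖ + 1 : ℝ) : ℂ), norm_mul, norm_mul,
      norm_pow, norm_pow, Complex.norm_real, Real.norm_of_nonneg (by positivity)]
    have : ‖w‖ < ‖x‖ + 1 := by simpa using hw
    gcongr

/-- The terms do not tend to `0`: the factorial quotient has a nonzero limit, because no parameter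
lies in `Omega q`, and `gaussTerm` stays away from `0`. -/
theorem seriesDiverges_vdBRTerm (hq0 : q ≠ 0) (hq : ‖q‖ < 1) {p : ℤ} {top bot : Multiset ℂ}
    (htop : ∀ x ∈ top, x ∉ Omega q) (hbot : ∀ y ∈ bot, y ∉ Omega q) {z : ℂ} (hz : z ≠ 0)
    (h : (bot.card : ℤ) + 1 - top.card + p < 0 ∨
      (bot.card : ℤ) + 1 - top.card + p = 0 ∧ 1 ≤ ‖z‖) :
    SeriesDiverges (vdBRTerm p top bot q z) := by
  rintro ⟨s, hs⟩
  have h0 : Tendsto (vdBRTerm p top bot q z) atTop (𝓝 0) := by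
    have := (hs.comp (tendsto_add_atTop_nat 1)).sub hs
    rw [sub_self] at this
    refine this.congr fun n => ?_
    simp [Finset.sum_range_succ]
  obtain ⟨ε, hε, hle⟩ := exists_le_norm_gaussTerm hq0 hq hz h
  have hK := (tendsto_pochRatio hq0 hq top hbot).norm
  have hK0 : 0 < ‖(top.map fun x => qPochInf x q).prod /
      (qPochInf q q * (bot.map fun x => qPochInf x q).prod)‖ := by
    have hprod (s : Multiset ℂ) (hs : ∀ x ∈ s, x ∉ Omega q) :
        (s.map fun x => qPochInf x q).prod ≠ 0 := by
      refine Multiset.prod_ne_zero fun h0 => ?_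
      obtain ⟨y, hy, h0⟩ := Multiset.mem_map.1 h0
      exact qPochInf_ne_zero hq (hs y hy) h0
    exact norm_pos_iff.2 (div_ne_zero (hprod _ htop) (mul_ne_zero
      (qPochInf_ne_zero hq (notMem_Omega_of_norm_lt_one hq0 hq hq)) (hprod _ hbot)))
  have h1 := hK.mul_const ε
  refine absurd (le_of_tendsto_of_tendsto h1 h0.norm ?_) (not_le.2 (by simpa using mul_pos hK0 hε))
  filter_upwards [hle] with n hn
  rw [vdBRTerm_eq, norm_mul]
  gcongr

section parameters

variable {A B C D : ℕ} {t : ℂ} {a : Fin A → ℂ} {b : Fin B → ℂ} {c : Fin C → ℂ} {d : Fin D → ℂ}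

/-- The superscript `C - A` cancels the counts of `a` and `c`, leaving an exponent that depends only
on `b` and `d`. -/
theorem card_botPar_sub_card_topPar (k : Fin D) :
    ((botPar t a d q k).card : ℤ) + 1 - (topPar t b c d q k).card + ((C : ℤ) - A) =
      (D : ℤ) - B := by
  have hD : 0 < D := k.pos
  simp only [botPar, topPar, Multiset.card_add, Multiset.card_map, Finset.card_val,
    Finset.card_univ, Fintype.card_fin, Finset.card_erase_of_mem (Finset.mem_univ k)]
  lia

theorem notMem_Omega_of_mem_botPar (hq0 : q ≠ 0) (hd0 : ∀ l, d l ≠ 0) (k : Fin D)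
    (hda : ∀ k i, t * d k * a i ∉ Omega q) (hdd : ∀ l l', l ≠ l' → d l / d l' ∉ Omega q) :
    ∀ y ∈ botPar t a d q k, y ∉ Omega q := by
  intro y hy
  rcases Multiset.mem_add.1 hy with hy | hy
  · obtain ⟨i, -, rfl⟩ := Multiset.mem_map.1 hy
    exact hda k i
  · obtain ⟨l, hl, rfl⟩ := Multiset.mem_map.1 hy
    rintro ⟨n, hn⟩
    refine hdd k l (Finset.ne_of_mem_erase (Finset.mem_def.2 hl)).symm ⟨n + 1, ?_⟩
    have := hd0 l
    rw [pow_succ, mul_inv, ← hn]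
    field_simp

theorem arg_ne_zero (hq0 : q ≠ 0) (hd0 : ∀ l, d l ≠ 0) (hb0 : ∀ j, b j ≠ 0) (m : ℤ) (k : Fin D) :
    arg m b d q k ≠ 0 :=
  mul_ne_zero (mul_ne_zero (zpow_ne_zero _ hq0) (zpow_ne_zero _ (mul_ne_zero hq0 (hd0 k))))
    (div_ne_zero (Finset.prod_ne_zero_iff.2 fun j _ => hb0 j)
      (Finset.prod_ne_zero_iff.2 fun l _ => hd0 l))

theorem norm_arg_of_eq (h : B = D) (m : ℤ) (k : Fin D) :
    ‖arg m b d q k‖ = ‖q ^ m * ∏ j, b j‖ / ‖∏ l, d l‖ := by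
  subst h
  rw [arg, sub_self, zpow_zero, mul_one, mul_div_assoc', norm_div]

end parameters

end QSeries

end

/-! ### The contour integral and its reflection symmetry -/

noncomputable section

/-- With respect to the angle, the mean of `f` over a circle about `0` is the circle integral of
`f w / w`. -/
theorem circleIntegral_div_self_eq {R : ℝ} (hR : R ≠ 0) (f : ℂ → ℂ) :
    (∮ w in C(0, R), f w / w) =
      Complex.I * ∫ θ in (-Real.pi)..Real.pi, f (circleMap 0 R θ) := by
  have hper : Function.Periodic (fun θ => f (circleMap 0 R θ)) (2 * Real.pi) :=
    (periodic_circleMap 0 R).comp f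
  have h := hper.intervalIntegral_add_eq (-Real.pi) 0
  rw [show -Real.pi + 2 * Real.pi = Real.pi by ring, zero_add] at h
  rw [h, circleIntegral, ← intervalIntegral.integral_const_mul]
  refine intervalIntegral.integral_congr fun θ _ => ?_
  have : circleMap 0 R θ ≠ 0 := circleMap_ne_center hR
  simp only [deriv_circleMap, smul_eq_mul]
  field_simp

/-- Inversion runs the circle backwards and `t` rotates it by its argument; periodicity absorbs
both. -/
theorem integral_circleMap_comp_inv {t : ℂ} {R : ℝ} (f : ℂ → ℂ) :
    (∫ θ in (-Real.pi)..Real.pi, f (t * circleMap 0 R θ)⁻¹) =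
      ∫ θ in (-Real.pi)..Real.pi, f (circleMap 0 (‖t‖ * R)⁻¹ θ) := by
  have hmap (θ : ℝ) : (t * circleMap 0 R θ)⁻¹ = circleMap 0 (‖t‖ * R)⁻¹ (-t.arg - θ) := by
    conv_lhs => rw [← Complex.norm_mul_exp_arg_mul_I t]
    simp only [circleMap, zero_add, mul_inv, ← Complex.exp_neg]
    push_cast
    rw [show (-(t.arg : ℂ) - θ) * Complex.I = -(t.arg * Complex.I) + -(θ * Complex.I) by ring,
      Complex.exp_add]
    ring
  have hper : Function.Periodic (fun θ => f (circleMap 0 (‖t‖ * R)⁻¹ θ)) (2 * Real.pi) :=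
    (periodic_circleMap 0 _).comp f
  have h := hper.intervalIntegral_add_eq (-t.arg - Real.pi) (-Real.pi)
  simp only [hmap]
  rw [intervalIntegral.integral_comp_sub_left (fun θ => f (circleMap 0 (‖t‖ * R)⁻¹ θ))]
  convert h using 2 <;> ring

namespace QSeries

variable {A B C D : ℕ} {q t : ℂ} {a : Fin A → ℂ} {b : Fin B → ℂ} {c : Fin C → ℂ} {d : Fin D → ℂ}

/-- The integrand of `G` as a function of `w = z / σ`. -/
def kernel (m : ℤ) (t : ℂ) (a : Fin A → ℂ) (b : Fin B → ℂ) (c : Fin C → ℂ) (d : Fin D → ℂ)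
    (q w : ℂ) : ℂ :=
  (qPochInfs (fun j => b j / w) q * qPochInfs (fun i => t * a i * w) q) /
    (qPochInfs (fun l => d l / w) q * qPochInfs (fun k => t * c k * w) q) * w ^ m

theorem integrand_eq {σ : ℝ} (hσ : 0 < σ) (m : ℤ) (ψ : ℝ) :
    integrand m t a b c d σ q ψ = (σ : ℂ) ^ m * kernel m t a b c d q (circleMap 0 (1 / σ) ψ) := by
  have hσ' : (σ : ℂ) ≠ 0 := by exact_mod_cast hσ.ne'
  have hw : circleMap 0 (1 / σ) ψ = Complex.exp (Complex.I * ψ) / σ := by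
    rw [circleMap, zero_add, mul_comm Complex.I]
    push_cast
    ring
  have hz : Complex.exp (Complex.I * m * ψ) = Complex.exp (Complex.I * ψ) ^ m := by
    rw [← Complex.exp_int_mul]
    ring_nf
  rw [hw, integrand, kernel, hz, div_zpow]
  rw [mul_left_comm, mul_div_cancel₀ _ (zpow_ne_zero m hσ')]
  simp only [div_div_eq_mul_div, mul_div_assoc]

theorem G_eq {σ : ℝ} (hσ : 0 < σ) (m : ℤ) :
    G m t a b c d σ q = qPochInf q q / (2 * Real.pi) * Complex.sqrt t ^ m *
      ∫ ψ in (-Real.pi)..Real.pi, kernel m t a b c d q (circleMap 0 (1 / σ) ψ) := by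
  have hσ' : (σ : ℂ) ^ m ≠ 0 := zpow_ne_zero _ (by exact_mod_cast hσ.ne')
  simp only [G, integrand_eq hσ, intervalIntegral.integral_const_mul, div_zpow]
  field_simp

theorem G_eq_circleIntegral {σ : ℝ} (hσ : 0 < σ) (m : ℤ) :
    G m t a b c d σ q = qPochInf q q * Complex.sqrt t ^ m * ((2 * Real.pi * Complex.I)⁻¹ *
      ∮ w in C(0, 1 / σ), kernel m t a b c d q w / w) := by
  rw [G_eq hσ, circleIntegral_div_self_eq (by positivity)]
  field_simp

theorem differentiableAt_qPochInfs (hq : ‖q‖ < 1) {n : ℕ} {f : Fin n → ℂ → ℂ} {w : ℂ}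
    (hf : ∀ i, DifferentiableAt ℂ (f i) w) :
    DifferentiableAt ℂ (fun w => qPochInfs (fun i => f i w) q) w := by
  unfold qPochInfs
  exact DifferentiableAt.fun_finsetProd fun i _ =>
    (differentiable_qPochInf hq (f i w)).comp w (hf i)

theorem differentiableAt_qPochInfs_div (hq : ‖q‖ < 1) {n : ℕ} (f : Fin n → ℂ) {w : ℂ}
    (hw : w ≠ 0) : DifferentiableAt ℂ (fun w => qPochInfs (fun i => f i / w) q) w :=
  differentiableAt_qPochInfs hq fun i => by fun_prop (disch := assumption)

theorem differentiableAt_qPochInfs_mul (hq : ‖q‖ < 1) {n : ℕ} (f : Fin n → ℂ) (w : ℂ) :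
    DifferentiableAt ℂ (fun w => qPochInfs (fun i => f i * w) q) w :=
  differentiableAt_qPochInfs hq fun i => by fun_prop

theorem qPochInfs_ne_zero (hq : ‖q‖ < 1) {n : ℕ} {f : Fin n → ℂ} (hf : ∀ i, f i ∉ Omega q) :
    qPochInfs f q ≠ 0 :=
  Finset.prod_ne_zero_iff.2 fun i _ => qPochInf_ne_zero hq (hf i)

theorem differentiableAt_kernel (hq : ‖q‖ < 1) (m : ℤ) {w : ℂ} (hw : w ≠ 0)
    (hd : ∀ l, d l / w ∉ Omega q) (hc : ∀ k, t * c k * w ∉ Omega q) :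
    DifferentiableAt ℂ (kernel m t a b c d q) w :=
  ((((differentiableAt_qPochInfs_div hq b hw).mul
    (differentiableAt_qPochInfs_mul hq (fun i => t * a i) w)).div
    ((differentiableAt_qPochInfs_div hq d hw).mul
    (differentiableAt_qPochInfs_mul hq (fun k => t * c k) w))
    (mul_ne_zero (qPochInfs_ne_zero hq hd) (qPochInfs_ne_zero hq hc)))).mul
    (differentiableAt_zpow.2 (Or.inl hw))

theorem differentiableAt_kernel_of_norm (hq0 : q ≠ 0) (hq : ‖q‖ < 1) (m : ℤ) {w : ℂ} (hw : w ≠ 0)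
    (hd : ∀ l, ‖d l‖ < ‖w‖) (hc : ∀ k, ‖t‖ * ‖c k‖ * ‖w‖ < 1) :
    DifferentiableAt ℂ (kernel m t a b c d q) w := by
  refine differentiableAt_kernel hq m hw (fun l => notMem_Omega_of_norm_lt_one hq0 hq ?_)
    (fun k => notMem_Omega_of_norm_lt_one hq0 hq ?_)
  · rw [norm_div, div_lt_one (norm_pos_iff.2 hw)]
    exact hd l
  · rw [norm_mul, norm_mul]
    exact hc k

theorem kernel_inv (ht : t ≠ 0) (m : ℤ) {w : ℂ} (hw : w ≠ 0) :
    kernel m t a b c d q w = (t ^ m)⁻¹ * kernel (-m) t b a d c q (t * w)⁻¹ := by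
  have h1 {n : ℕ} (f : Fin n → ℂ) : (fun i => t * f i * (t * w)⁻¹) = fun i => f i / w := by
    funext i
    field_simp
  have h2 {n : ℕ} (f : Fin n → ℂ) : (fun i => f i / (t * w)⁻¹) = fun i => t * f i * w := by
    funext i
    field_simp
  have h3 : (t * w)⁻¹ ^ (-m) = t ^ m * w ^ m := by
    rw [inv_zpow', neg_neg, mul_zpow]
  have h4 : t ^ m ≠ 0 := zpow_ne_zero _ ht
  rw [kernel, kernel, h1, h1, h2, h2, h3]
  field_simp

theorem sqrt_zpow_mul_inv (ht : t ≠ 0) (m : ℤ) :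
    Complex.sqrt t ^ m * (t ^ m)⁻¹ = Complex.sqrt t ^ (-m) := by
  have h : Complex.sqrt t ^ 2 = t := by simp [Complex.sqrt]
  have h0 : Complex.sqrt t ≠ 0 := fun h0 => ht (by rw [← h, h0]; simp)
  nth_rw 2 [← h]
  rw [← zpow_natCast, ← zpow_mul, ← zpow_neg, ← zpow_add₀ h0]
  congr 1
  push_cast
  ring

/-- The substitution `w ↦ 1 / (t w)` exchanges the two families of parameters. -/
theorem G_eq_G_neg (ht : t ≠ 0) {σ : ℝ} (hσ : 0 < σ) (m : ℤ) :
    G m t a b c d σ q = G (-m) t b a d c (‖t‖ / σ) q := by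
  have ht' := norm_pos_iff.2 ht
  have h1 (ψ : ℝ) := kernel_inv (q := q) (a := a) (b := b) (c := c) (d := d) ht m
    (circleMap_ne_center (c := 0) (θ := ψ) (one_div_pos.2 hσ).ne')
  rw [G_eq hσ, G_eq (by positivity)]
  simp only [h1, intervalIntegral.integral_const_mul]
  rw [integral_circleMap_comp_inv (kernel (-m) t b a d c q), ← sqrt_zpow_mul_inv ht]
  rw [show (‖t‖ * (1 / σ))⁻¹ = 1 / (‖t‖ / σ) by field_simp]
  ring

theorem intervalIntegrable_integrand (hq0 : q ≠ 0) (hq : ‖q‖ < 1) (m : ℤ) (ht : t ≠ 0) {σ : ℝ}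
    (hσ : 0 < σ) (hc : ∀ k, ‖c k‖ < σ / ‖t‖) (hd : ∀ l, ‖d l‖ < 1 / σ) :
    IntervalIntegrable (integrand m t a b c d σ q) MeasureTheory.volume
      (-Real.pi) Real.pi := by
  have ht' := norm_pos_iff.2 ht
  refine Continuous.intervalIntegrable ?_ _ _
  rw [funext (integrand_eq hσ m)]
  refine continuous_const.mul (continuous_iff_continuousAt.2 fun ψ => ?_)
  have hn : ‖circleMap 0 (1 / σ) ψ‖ = 1 / σ := by
    rw [norm_circleMap_zero, abs_of_pos (by positivity)]
  refine ContinuousAt.comp (f := circleMap 0 (1 / σ)) (DifferentiableAt.continuousAt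
    (differentiableAt_kernel_of_norm hq0 hq m (circleMap_ne_center (by positivity)) ?_ ?_))
    (continuous_circleMap 0 _).continuousAt
  · simpa only [hn] using hd
  · intro k
    have h := hc k
    rw [lt_div_iff₀ ht'] at h
    rw [hn, mul_one_div, div_lt_one hσ, mul_comm]
    exact h

/-- The annulus `1/τ ≤ ‖w‖ ≤ 1/σ` contains no pole: the points `d_l q^n` lie below it, the points
`1/(t c_k q^n)` above. -/
theorem G_eq_of_radius_le (hq0 : q ≠ 0) (hq : ‖q‖ < 1) (m : ℤ) {σ τ : ℝ} (hσ : 0 < σ)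
    (hστ : σ ≤ τ) (ht : t ≠ 0) (hc : ∀ k, ‖c k‖ < σ / ‖t‖) (hd : ∀ l, ‖d l‖ < 1 / τ) :
    G m t a b c d σ q = G m t a b c d τ q := by
  have ht' := norm_pos_iff.2 ht
  have hτ := hσ.trans_le hστ
  rw [G_eq_circleIntegral hσ, G_eq_circleIntegral hτ,
    circleIntegral_eq_of_differentiableAt_annulus (one_div_pos.2 hτ)
      (one_div_le_one_div_of_le hσ hστ)]
  intro w h1 h2
  have hw : w ≠ 0 := norm_pos_iff.1 ((one_div_pos.2 hτ).trans_le h1)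
  refine (differentiableAt_kernel_of_norm hq0 hq m hw (fun l => (hd l).trans_le h1) fun k => ?_).div
    differentiableAt_id hw
  have h := hc k
  rw [lt_div_iff₀ ht'] at h
  rw [le_div_iff₀ hσ] at h2
  nlinarith [norm_nonneg w, norm_pos_iff.2 hw]

theorem G_reflection (hq0 : q ≠ 0) (hq : ‖q‖ < 1) (m : ℤ) (ht : t ≠ 0) {σ : ℝ} (hσ : 0 < σ)
    (hc : ∀ k, ‖c k‖ < min (1 / σ) (σ / ‖t‖)) (hd : ∀ l, ‖d l‖ < min (1 / σ) (σ / ‖t‖)) :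
    G m t a b c d σ q = G (-m) t b a d c σ q := by
  have ht' := norm_pos_iff.2 ht
  have e1 : ‖t‖ / σ / ‖t‖ = 1 / σ := by field_simp
  have e2 : 1 / (‖t‖ / σ) = σ / ‖t‖ := by field_simp
  rw [G_eq_G_neg ht hσ]
  -- Whichever radius is larger, the bounds by the minimum keep the annulus between `1/σ` and
  -- `σ/‖t‖` free of poles.
  rcases le_total σ (‖t‖ / σ) with h | h
  · refine (G_eq_of_radius_le hq0 hq (-m) hσ h ht (fun k => (hd k).trans_le (min_le_right _ _))
      fun l => ?_).symm
    rw [e2]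
    exact (hc l).trans_le (min_le_right _ _)
  · refine G_eq_of_radius_le hq0 hq (-m) (by positivity) h ht (fun k => ?_)
      fun l => (hc l).trans_le (min_le_left _ _)
    rw [e1]
    exact (hd k).trans_le (min_le_left _ _)

end QSeries

end

/-! ### Decay of the kernel at the origin and its residues -/

noncomputable section

namespace QSeries

variable {A B C D : ℕ} {q t : ℂ} {a : Fin A → ℂ} {b : Fin B → ℂ} {c : Fin C → ℂ} {d : Fin D → ℂ}

theorem qPochInfs_div_mul (hq0 : q ≠ 0) (hq : ‖q‖ < 1) {n : ℕ} (f : Fin n → ℂ) {w : ℂ}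
    (hw : w ≠ 0) : qPochInfs (fun i => f i / (q * w)) q =
      (∏ i, (q * w - f i)) / (q * w) ^ n * qPochInfs (fun i => f i / w) q := by
  have h : (q * w) ^ n = ∏ _i : Fin n, q * w := by simp
  rw [h, qPochInfs, qPochInfs, ← Finset.prod_div_distrib, ← Finset.prod_mul_distrib]
  refine Finset.prod_congr rfl fun i _ => ?_
  rw [qPochInf_eq_one_sub_mul hq (f i / (q * w)), show f i / (q * w) * q = f i / w by field_simp]
  congr 1
  field_simp

theorem qPochInfs_eq_prod_mul (hq : ‖q‖ < 1) {n : ℕ} (f : Fin n → ℂ) (w : ℂ) :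
    qPochInfs (fun i => t * f i * w) q =
      (∏ i, (1 - t * f i * w)) * qPochInfs (fun i => t * f i * (q * w)) q := by
  rw [qPochInfs, qPochInfs, ← Finset.prod_mul_distrib]
  refine Finset.prod_congr rfl fun i _ => ?_
  rw [qPochInf_eq_one_sub_mul hq (t * f i * w), show t * f i * w * q = t * f i * (q * w) by ring]

/-- Near `0` the kernel decreases geometrically under `w ↦ q w`. -/
theorem exists_norm_kernel_mul_le (hq0 : q ≠ 0) (hq : ‖q‖ < 1) (m : ℤ) (hd0 : ∀ l, d l ≠ 0)
    (h : B < D ∨ (B = D ∧ ‖q ^ m * ∏ j, b j‖ < ‖∏ l, d l‖)) :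
    ∃ δ > 0, ∃ ρ, 0 ≤ ρ ∧ ρ < (1 : ℝ) ∧ ∀ w : ℂ, w ≠ 0 → ‖w‖ < δ →
      ‖kernel m t a b c d q (q * w)‖ ≤ ρ * ‖kernel m t a b c d q w‖ := by
  have hBD : B ≤ D := by lia
  have hdprod : ∏ l, d l ≠ 0 := Finset.prod_ne_zero_iff.2 fun l _ => hd0 l
  -- `F` is the multiplier of the kernel under `w ↦ q w`. At `0` it vanishes if `B < D`; if `B = D`,
  -- the signs of the `-b j` and `-d l` cancel and its value is `q^m ∏ b / ∏ d`.
  set F : ℂ → ℂ := fun w => q ^ m * (q * w) ^ (D - B) *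
    ((∏ j, (q * w - b j)) / ∏ l, (q * w - d l)) *
    ((∏ k, (1 - t * c k * w)) / ∏ i, (1 - t * a i * w)) with hF
  have hd' : (∏ l, (q * 0 - d l)) ≠ 0 := Finset.prod_ne_zero_iff.2 fun l _ => by simp [hd0 l]
  have ha' : (∏ i, (1 - t * a i * 0)) ≠ 0 := by simp
  have hc' : (∏ k, (1 - t * c k * 0)) ≠ 0 := by simp
  have hcont {n : ℕ} (f : Fin n → ℂ) : ContinuousAt (fun w : ℂ => ∏ i, (1 - t * f i * w)) 0 := by
    fun_prop
  have hcontd {n : ℕ} (f : Fin n → ℂ) : ContinuousAt (fun w : ℂ => ∏ i, (q * w - f i)) 0 := by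
    fun_prop
  have hFc : ContinuousAt F 0 := by
    refine ContinuousAt.mul (ContinuousAt.mul (by fun_prop) ((hcontd b).div (hcontd d) hd'))
      ((hcont c).div (hcont a) ha')
  have hF0 : ‖F 0‖ < 1 := by
    rcases h with h | ⟨rfl, h⟩
    · have : D - B ≠ 0 := by lia
      simp [hF, this]
    · have e (f : Fin B → ℂ) : ‖∏ i, (q * 0 - f i)‖ = ‖∏ i, f i‖ := by simp [norm_prod]
      simp only [hF, Nat.sub_self, pow_zero, mul_one, mul_zero, sub_zero, Finset.prod_const_one,
        div_one, norm_mul, norm_div] at h ⊢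
      simp only [mul_zero] at e
      rw [e, e, mul_div_assoc', div_lt_one (norm_pos_iff.2 hdprod)]
      exact h
  obtain ⟨ρ, hρ0, hρ1⟩ := exists_between hF0
  have hev : ∀ᶠ w in 𝓝 (0 : ℂ), ‖F w‖ < ρ ∧ (∏ i, (1 - t * a i * w)) ≠ 0 ∧
      (∏ k, (1 - t * c k * w)) ≠ 0 :=
    (hFc.norm.eventually_lt_const hρ0).and
      (((hcont a).eventually_ne ha').and ((hcont c).eventually_ne hc'))
  obtain ⟨δ, hδ, hδF⟩ := Metric.eventually_nhds_iff.1 hev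
  refine ⟨δ, hδ, ρ, (norm_nonneg _).trans hρ0.le, hρ1, fun w hw hwδ => ?_⟩
  obtain ⟨h1, h2, h3⟩ := hδF (by simpa using hwδ)
  have hkey : kernel m t a b c d q (q * w) = F w * kernel m t a b c d q w := by
    have hqw : q * w ≠ 0 := mul_ne_zero hq0 hw
    have hpow : (q * w) ^ D = (q * w) ^ B * (q * w) ^ (D - B) := by
      rw [← pow_add, Nat.add_sub_cancel' hBD]
    rw [kernel, kernel, qPochInfs_div_mul hq0 hq b hw, qPochInfs_div_mul hq0 hq d hw,
      qPochInfs_eq_prod_mul hq a w, qPochInfs_eq_prod_mul hq c w, hF, hpow, mul_zpow]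
    have := pow_ne_zero B hqw
    have := pow_ne_zero (D - B) hqw
    beta_reduce
    generalize (q * w) ^ B = x at *
    generalize (q * w) ^ (D - B) = y at *
    generalize (∏ i, (1 - t * a i * w)) = u at *
    generalize (∏ k, (1 - t * c k * w)) = v at *
    field_simp
  rw [hkey, norm_mul]
  gcongr

/-- Iterating the decay bounds the kernel by `ρ^N K` on the `N`-th circle, and the factor `1/w`
compensates the length of that circle exactly. -/
theorem tendsto_circleIntegral_kernel (hq0 : q ≠ 0) (m : ℤ) {δ ρ r : ℝ}
    (hq : ‖q‖ < 1) (hρ0 : 0 ≤ ρ) (hρ1 : ρ < 1) (h : ∀ w : ℂ, w ≠ 0 → ‖w‖ < δ →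
      ‖kernel m t a b c d q (q * w)‖ ≤ ρ * ‖kernel m t a b c d q w‖) (hr : 0 < r) (hrδ : r < δ)
    (hcont : ContinuousOn (kernel m t a b c d q) (Metric.sphere 0 r)) :
    Tendsto (fun N : ℕ => ∮ w in C(0, r * ‖q‖ ^ N), kernel m t a b c d q w / w) atTop (𝓝 0) := by
  have hq' : 0 < ‖q‖ := norm_pos_iff.2 hq0
  obtain ⟨K, hK⟩ := (isCompact_sphere (0 : ℂ) r).exists_bound_of_continuousOn hcont
  have hiter (N : ℕ) : ∀ w : ℂ, ‖w‖ = r → ‖kernel m t a b c d q (q ^ N * w)‖ ≤ ρ ^ N * K := by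
    induction N with
    | zero => intro w hw; simpa using hK w (by simpa using hw)
    | succ N ih =>
      intro w hw
      have hw0 : w ≠ 0 := norm_pos_iff.1 (hw ▸ hr)
      rw [pow_succ', mul_assoc, pow_succ', mul_assoc]
      refine (h _ (mul_ne_zero (pow_ne_zero _ hq0) hw0) ?_).trans
        (mul_le_mul_of_nonneg_left (ih w hw) hρ0)
      rw [norm_mul, norm_pow, hw]
      exact (mul_le_of_le_one_left hr.le (pow_le_one₀ hq'.le hq.le)).trans_lt hrδ
  have hlim : Tendsto (fun N : ℕ => 2 * Real.pi * (ρ ^ N * K)) atTop (𝓝 0) := by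
    simpa using ((tendsto_pow_atTop_nhds_zero_of_lt_one hρ0 hρ1).mul_const K).const_mul
      (2 * Real.pi)
  refine squeeze_zero_norm (fun N => ?_) hlim
  have hrN : 0 < r * ‖q‖ ^ N := by positivity
  refine (circleIntegral.norm_integral_le_of_norm_le_const hrN.le
    (C := ρ ^ N * K / (r * ‖q‖ ^ N)) fun w hw => ?_).trans_eq (by field_simp)
  rw [mem_sphere_zero_iff_norm] at hw
  rw [norm_div, hw]
  gcongr
  have := hiter N (w / q ^ N) (by rw [norm_div, hw, norm_pow]; field_simp)
  rwa [mul_div_cancel₀ _ (pow_ne_zero N hq0)] at this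

/-- The kernel times `w - d k * q ^ n`, divided by `w`; regular at `w = d k * q ^ n`. -/
def residueKernel (m : ℤ) (t : ℂ) (a : Fin A → ℂ) (b : Fin B → ℂ) (c : Fin C → ℂ) (d : Fin D → ℂ)
    (q : ℂ) (k : Fin D) (n : ℕ) (w : ℂ) : ℂ :=
  (qPochInfs (fun j => b j / w) q * qPochInfs (fun i => t * a i * w) q) /
    (qPoch (d k / w) q n * qPochInf (d k / w * q ^ (n + 1)) q *
      (∏ l ∈ Finset.univ.erase k, qPochInf (d l / w) q) *
      qPochInfs (fun k => t * c k * w) q) * w ^ m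

/-- The vanishing factor is `1 - d_k q^n / w = (w - d_k q^n)/w`, whose `1/w` cancels the one in
`dw/w`. -/
theorem kernel_div_eq (hq : ‖q‖ < 1) (m : ℤ) (k : Fin D) (n : ℕ) {w : ℂ} (hw : w ≠ 0) :
    kernel m t a b c d q w / w = residueKernel m t a b c d q k n w / (w - d k * q ^ n) := by
  have h1 : qPochInfs (fun l => d l / w) q = qPoch (d k / w) q n * ((w - d k * q ^ n) / w) *
      qPochInf (d k / w * q ^ (n + 1)) q * ∏ l ∈ Finset.univ.erase k, qPochInf (d l / w) q := by
    rw [qPochInfs, ← Finset.mul_prod_erase _ _ (Finset.mem_univ k),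
      qPochInf_eq_qPoch_mul hq (d k / w) (n + 1), qPoch_succ]
    congr 3
    field_simp
  rw [kernel, residueKernel, h1]
  simp only [div_eq_mul_inv, mul_inv, inv_inv]
  field_simp

theorem mul_pow_ne_mul_pow (hq0 : q ≠ 0) (hd0 : ∀ l, d l ≠ 0)
    (hdd : ∀ l l', l ≠ l' → d l / d l' ∉ Omega q) {l k : Fin D} (hlk : l ≠ k) (i j : ℕ) :
    d l * q ^ i ≠ d k * q ^ j := by
  have key : ∀ {l k : Fin D}, l ≠ k → ∀ i j : ℕ, i ≤ j → d l * q ^ i ≠ d k * q ^ j := by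
    intro l k hlk i j hij he
    refine hdd k l hlk.symm ⟨j - i, ?_⟩
    obtain ⟨e, rfl⟩ := Nat.exists_eq_add_of_le hij
    have h1 := hd0 l
    have h2 := pow_ne_zero i hq0
    have h3 := pow_ne_zero e hq0
    rw [Nat.add_sub_cancel_left, div_eq_iff h1, eq_inv_mul_iff_mul_eq₀ h3]
    refine mul_right_cancel₀ h2 ?_
    rw [he, pow_add]
    ring
  rcases le_total i j with h | h
  · exact key hlk i j h
  · exact (key hlk.symm j i h).symm

theorem eq_mul_pow_of_div_mem_Omega (hq0 : q ≠ 0) {x w : ℂ} (hw : w ≠ 0) {n : ℕ}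
    (h : x / w = (q ^ n)⁻¹) : w = x * q ^ n := by
  have := pow_ne_zero n hq0
  field_simp at h
  exact h.symm

theorem qPoch_inv_pow_ne_zero (hq0 : q ≠ 0) (hq : ‖q‖ < 1) (n : ℕ) :
    qPoch (1 / q ^ n) q n ≠ 0 := by
  rw [qPoch_div_pow hq0 one_ne_zero, div_one]
  exact mul_ne_zero (div_ne_zero (pow_ne_zero _ (by simpa using hq0)) (mul_ne_zero
    (pow_ne_zero _ (by norm_num)) (pow_ne_zero _ hq0)))
    (qPoch_ne_zero (notMem_Omega_of_norm_lt_one hq0 hq hq) n)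

/-- The pole is simple: at `d_k q^n` the rest of the `d_k` product is `(q^(-n);q)_n (q;q)_∞ ≠ 0`,
and the other `d_l` give no zero there because the pole families are disjoint. -/
theorem eventually_differentiableAt_residueKernel (hq0 : q ≠ 0) (hq : ‖q‖ < 1) (m : ℤ)
    (hd0 : ∀ l, d l ≠ 0) (hdd : ∀ l l', l ≠ l' → d l / d l' ∉ Omega q) (k : Fin D) (n : ℕ)
    (hc : ∀ i, ‖t * c i * (d k * q ^ n)‖ < 1) :
    ∀ᶠ w in 𝓝 (d k * q ^ n), DifferentiableAt ℂ (residueKernel m t a b c d q k n) w := by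
  have hp : d k * q ^ n ≠ 0 := mul_ne_zero (hd0 k) (pow_ne_zero n hq0)
  set den : ℂ → ℂ := fun w => qPoch (d k / w) q n * qPochInf (d k / w * q ^ (n + 1)) q *
      (∏ l ∈ Finset.univ.erase k, qPochInf (d l / w) q) *
      qPochInfs (fun k => t * c k * w) q with hden
  have hP {f : ℂ → ℂ} {w : ℂ} (hf : DifferentiableAt ℂ f w) :
      DifferentiableAt ℂ (fun w => qPochInf (f w) q) w :=
    (differentiable_qPochInf hq (f w)).comp w hf
  have hdiff : ∀ w ≠ 0, DifferentiableAt ℂ den w := by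
    intro w hw
    refine (((DifferentiableAt.mul ?_ ?_).mul ?_).mul
      (differentiableAt_qPochInfs_mul hq (fun i => t * c i) w))
    · unfold qPoch
      fun_prop (disch := assumption)
    · exact hP (by fun_prop (disch := assumption))
    · exact DifferentiableAt.fun_finsetProd fun l _ => hP (by fun_prop (disch := assumption))
  have hne : den (d k * q ^ n) ≠ 0 := by
    have hk := hd0 k
    have e1 : d k / (d k * q ^ n) = 1 / q ^ n := by field_simp
    have e2 : 1 / q ^ n * q ^ (n + 1) = q := by rw [pow_succ]; field_simp
    refine mul_ne_zero (mul_ne_zero (mul_ne_zero ?_ ?_) ?_) ?_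
    · rw [e1]
      exact qPoch_inv_pow_ne_zero hq0 hq n
    · rw [e1, e2]
      exact qPochInf_ne_zero hq (notMem_Omega_of_norm_lt_one hq0 hq hq)
    · refine Finset.prod_ne_zero_iff.2 fun l hl => qPochInf_ne_zero hq ?_
      rintro ⟨j, hj⟩
      exact mul_pow_ne_mul_pow hq0 hd0 hdd (Finset.ne_of_mem_erase hl).symm n j
        (eq_mul_pow_of_div_mem_Omega hq0 hp hj)
    · exact qPochInfs_ne_zero hq fun i => notMem_Omega_of_norm_lt_one hq0 hq (hc i)
  filter_upwards [(hdiff _ hp).continuousAt.eventually_ne hne, eventually_ne_nhds hp] with w h1 h2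
  exact (((differentiableAt_qPochInfs_div hq b h2).mul
    (differentiableAt_qPochInfs_mul hq (fun i => t * a i) w)).div (hdiff w h2) h1).mul
    (differentiableAt_zpow.2 (Or.inl h2))

/-- `M l` counts the poles `d_l q^n` lying in the annulus; their moduli decrease with `n`, so these
are the first `M l` ones. -/
theorem circleIntegral_kernel_eq_add_sum (hq0 : q ≠ 0) (hq : ‖q‖ < 1) (m : ℤ)
    (hd0 : ∀ l, d l ≠ 0) (hdd : ∀ l l', l ≠ l' → d l / d l' ∉ Omega q) {r R : ℝ} (hr : 0 < r)
    (hrR : r < R) (hc : ∀ k, ‖t * c k‖ * R < 1) (hd : ∀ l, ‖d l‖ < R) (M : Fin D → ℕ)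
    (hM : ∀ l n, n < M l → r < ‖d l * q ^ n‖) (hM' : ∀ l n, M l ≤ n → ‖d l * q ^ n‖ < r) :
    (∮ w in C(0, R), kernel m t a b c d q w / w) =
      (∮ w in C(0, r), kernel m t a b c d q w / w) + 2 * Real.pi * Complex.I *
        ∑ k, ∑ n ∈ Finset.range (M k), residueKernel m t a b c d q k n (d k * q ^ n) := by
  have hpR (l : Fin D) (n : ℕ) : ‖d l * q ^ n‖ < R := by
    rw [norm_mul, norm_pow]
    exact (mul_le_of_le_one_right (norm_nonneg _) (pow_le_one₀ (norm_nonneg _) hq.le)).trans_lt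
      (hd l)
  have hcw {w : ℂ} (hw : ‖w‖ ≤ R) (i : Fin C) : ‖t * c i * w‖ < 1 := by
    rw [norm_mul]
    exact (mul_le_mul_of_nonneg_left hw (norm_nonneg _)).trans_lt (hc i)
  have hp (l : Fin D) (n : ℕ) : d l * q ^ n ≠ 0 := mul_ne_zero (hd0 l) (pow_ne_zero n hq0)
  rw [circleIntegral_eq_add_sum_residues hr hrR
    (Finset.univ.sigma fun k : Fin D => Finset.range (M k)) (fun i => d i.1 * q ^ i.2) ?_ ?_
    (fun i => residueKernel m t a b c d q i.1 i.2) ?_ _ ?_ ?_, Finset.sum_sigma]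
  · rintro ⟨l, i⟩ - ⟨k, j⟩ - h
    simp only at h
    by_cases hlk : l = k
    · subst hlk
      have h1 := congrArg norm (mul_left_cancel₀ (hd0 l) h)
      rw [norm_pow, norm_pow] at h1
      rw [pow_right_injective₀ (norm_pos_iff.2 hq0) hq.ne h1]
    · exact absurd h (mul_pow_ne_mul_pow hq0 hd0 hdd hlk i j)
  · rintro ⟨l, n⟩ h
    simp only [Finset.mem_sigma, Finset.mem_univ, Finset.mem_range, true_and] at h
    exact ⟨hM l n h, hpR l n⟩
  · rintro ⟨l, n⟩ -
    exact eventually_differentiableAt_residueKernel hq0 hq m hd0 hdd l n (hcw (hpR l n).le)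
  · intro w h1 h2 h3
    have hw : w ≠ 0 := norm_pos_iff.1 (hr.trans_le h1)
    refine (differentiableAt_kernel hq m hw ?_ fun i =>
      notMem_Omega_of_norm_lt_one hq0 hq (hcw h2 i)).div differentiableAt_id hw
    rintro l ⟨n, hn⟩
    have he := eq_mul_pow_of_div_mem_Omega hq0 hw hn
    rcases lt_or_ge n (M l) with hlt | hge
    · exact h3 ⟨l, n⟩ (by simpa using hlt) he
    · exact absurd (hM' l n hge) (not_lt.2 (he ▸ h1))
  · rintro ⟨l, n⟩ -
    filter_upwards [nhdsWithin_le_nhds (eventually_ne_nhds (hp l n))] with w hw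
    exact kernel_div_eq hq m l n hw

end QSeries

end

/-! ### Residues as series terms, and the expansion of `G` -/

noncomputable section

namespace QSeries

variable {A B C D : ℕ} {q t : ℂ} {a : Fin A → ℂ} {b : Fin B → ℂ} {c : Fin C → ℂ} {d : Fin D → ℂ}

theorem prod_qPochInf_div_pow (hq0 : q ≠ 0) (hq : ‖q‖ < 1) {ι : Type*} (s : Finset ι) (f : ι → ℂ)
    (hf : ∀ i, f i ≠ 0) {x : ℂ} (hx : x ≠ 0) (n : ℕ) :
    ∏ i ∈ s, qPochInf (f i / (x * q ^ n)) q =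
      ((∏ i ∈ s, f i) / (q * x) ^ s.card) ^ n / ((-1) ^ n * q ^ n.choose 2) ^ s.card *
        (∏ i ∈ s, qPoch (q * x / f i) q n) * ∏ i ∈ s, qPochInf (f i / x) q := by
  have h (i : ι) : qPochInf (f i / (x * q ^ n)) q =
      (f i / (q * x)) ^ n / ((-1) ^ n * q ^ n.choose 2) * qPoch (q * x / f i) q n *
        qPochInf (f i / x) q := by
    rw [← div_div, qPochInf_div_pow hq0 hq (div_ne_zero (hf i) hx), div_div, mul_comm x q,
      div_div_eq_mul_div]
  simp only [h, Finset.prod_mul_distrib, Finset.prod_div_distrib, Finset.prod_pow,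
    Finset.prod_const, div_pow]
  simp only [mul_pow, ← pow_mul, mul_comm s.card]

theorem qPochInfs_mul_pow (hq : ‖q‖ < 1) {n : ℕ} (f : Fin n → ℂ) (x : ℂ) (N : ℕ) :
    qPochInfs (fun i => t * x * f i) q =
      (∏ i, qPoch (t * x * f i) q N) * qPochInfs (fun i => t * f i * (x * q ^ N)) q := by
  rw [qPochInfs, qPochInfs, ← Finset.prod_mul_distrib]
  refine Finset.prod_congr rfl fun i _ => ?_
  rw [qPochInf_eq_qPoch_mul hq _ N]
  congr 2
  ring

theorem vdBRTerm_par_eq (k : Fin D) (z : ℂ) (n : ℕ) :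
    vdBRTerm ((C : ℤ) - A) (topPar t b c d q k) (botPar t a d q k) q z n =
      ((∏ i, qPoch (t * d k * c i) q n) * ∏ j, qPoch (q * d k / b j) q n) /
        (qPoch q q n * ((∏ i, qPoch (t * d k * a i) q n) *
          ∏ l ∈ Finset.univ.erase k, qPoch (q * d k / d l) q n)) *
      gaussTerm ((D : ℤ) - B) q z n := by
  rw [vdBRTerm_eq, card_botPar_sub_card_topPar, pochRatio, topPar, botPar]
  simp only [Multiset.map_add, Multiset.prod_add, Multiset.map_map, Function.comp_def]
  rfl

/-- The right side collects what reversing the products pulls out: `B` factors from `b`, `D - 1`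
from the `d_l` with `l ≠ k`, and one more from `(q^(-n);q)_n`, giving the exponent `D - B`. -/
theorem gaussTerm_arg (hq0 : q ≠ 0) (m : ℤ) (hd0 : ∀ l, d l ≠ 0) (k : Fin D) (n : ℕ) :
    gaussTerm ((D : ℤ) - B) q (arg m b d q k) n =
      ((∏ j, b j) / (q * d k) ^ B) ^ n / ((-1) ^ n * q ^ n.choose 2) ^ B * (q ^ n) ^ m /
        (((∏ l ∈ Finset.univ.erase k, d l) / (q * d k) ^ (D - 1)) ^ n /
          ((-1) ^ n * q ^ n.choose 2) ^ (D - 1) *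
          ((1 / q) ^ n / ((-1) ^ n * q ^ n.choose 2))) := by
  have hk := hd0 k
  have hD : 0 < D := k.pos
  have hu : (-1 : ℂ) ^ n * q ^ n.choose 2 ≠ 0 :=
    mul_ne_zero (pow_ne_zero _ (by norm_num)) (pow_ne_zero _ hq0)
  have hq' : (q ^ n) ^ m = (q ^ m) ^ n := by
    rw [← zpow_natCast, ← zpow_natCast, ← zpow_mul, ← zpow_mul, mul_comm]
  have hqd : q * d k ≠ 0 := mul_ne_zero hq0 hk
  have hE : ∏ l ∈ Finset.univ.erase k, d l ≠ 0 := Finset.prod_ne_zero_iff.2 fun l _ => hd0 l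
  rw [gaussTerm, arg, ← Finset.mul_prod_erase _ _ (Finset.mem_univ k), hq', zpow_sub₀ hu,
    zpow_sub₀ hqd, zpow_natCast, zpow_natCast, zpow_natCast, zpow_natCast]
  obtain ⟨e, rfl⟩ : ∃ e, D = e + 1 := ⟨D - 1, by lia⟩
  rw [Nat.add_sub_cancel, pow_succ _ e, pow_succ _ e]
  have h1 := pow_ne_zero B hqd
  have h2 := pow_ne_zero e hqd
  generalize (q * d k) ^ B = x1 at *
  generalize (q * d k) ^ e = x2 at *
  generalize (-1 : ℂ) ^ n * q ^ n.choose 2 = u at *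
  generalize (∏ l ∈ Finset.univ.erase k, d l) = y at *
  simp only [mul_pow, div_pow, one_pow]
  field_simp

/-- Only the cancelled quantities `P`, `y₁`, `y₂` need to be nonzero; the other denominators occur
as the same inverses on both sides. -/
theorem residue_rearrange {P y₁ y₂ : ℂ} (hP : P ≠ 0) (h₁ : y₁ ≠ 0) (h₂ : y₂ ≠ 0)
    {y₃ y₄ y₅ y₆ y₇ z₁ z₂ z₃ z₄ v x₃ x₄ : ℂ} :
    P * (y₆ * y₃ * z₃ * z₁ / (v * x₄ * P * (y₇ * y₄ * z₄) * z₂) * (x₃ * y₅)) =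
      y₁ * z₁ * z₃ * x₃ / (y₂ * z₂ * z₄) *
        (y₂ * y₃ / (x₄ * (y₁ * y₄)) * (y₆ * y₅ / (y₇ * v))) := by
  have h : P * P⁻¹ = y₁ * y₁⁻¹ * (y₂ * y₂⁻¹) := by simp [hP, h₁, h₂]
  linear_combination (y₆ * y₃ * z₃ * z₁ * x₃ * y₅ / (v * x₄ * y₇ * y₄ * z₄ * z₂)) * h

theorem qPochInf_mul_residueKernel (hq0 : q ≠ 0) (hq : ‖q‖ < 1) (m : ℤ)
    (hd0 : ∀ l, d l ≠ 0) (hb0 : ∀ j, b j ≠ 0) (hda : ∀ k i, t * d k * a i ∉ Omega q)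
    (hdc : ∀ k i, t * d k * c i ∉ Omega q) (k : Fin D) (n : ℕ) :
    qPochInf q q * residueKernel m t a b c d q k n (d k * q ^ n) =
      coeff m t a b c d q k *
        vdBRTerm ((C : ℤ) - A) (topPar t b c d q k) (botPar t a d q k) q (arg m b d q k) n := by
  have hk := hd0 k
  have e1 : d k / (d k * q ^ n) = 1 / q ^ n := by field_simp
  have e2 : 1 / q ^ n * q ^ (n + 1) = q := by rw [pow_succ]; field_simp
  have hP : qPochInf q q ≠ 0 := qPochInf_ne_zero hq (notMem_Omega_of_norm_lt_one hq0 hq hq)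
  have hA := qPochInfs_mul_pow (t := t) hq a (d k) n
  have hC := qPochInfs_mul_pow (t := t) hq c (d k) n
  have hA0 : ∏ i, qPoch (t * d k * a i) q n ≠ 0 :=
    Finset.prod_ne_zero_iff.2 fun i _ => qPoch_ne_zero (hda k i) n
  have hC0 : ∏ i, qPoch (t * d k * c i) q n ≠ 0 :=
    Finset.prod_ne_zero_iff.2 fun i _ => qPoch_ne_zero (hdc k i) n
  have hB := prod_qPochInf_div_pow hq0 hq Finset.univ b hb0 hk n
  have hDk := prod_qPochInf_div_pow hq0 hq (Finset.univ.erase k) d hd0 hk n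
  rw [Finset.card_univ, Fintype.card_fin] at hB
  rw [Finset.card_erase_of_mem (Finset.mem_univ k), Finset.card_univ, Fintype.card_fin] at hDk
  rw [vdBRTerm_par_eq, gaussTerm_arg hq0 m hd0, residueKernel, coeff, hA, hC, e1, e2, hDk,
    qPoch_div_pow hq0 one_ne_zero, div_one, qPochInfs, hB, mul_zpow]
  exact residue_rearrange hP hA0 hC0

/-- Only countably many `r` are excluded, so one choice keeps every circle of radius `r|q|^N` off
the poles `d_l q^n`. -/
theorem exists_radius_ne (hq0 : q ≠ 0) (d : Fin D → ℂ) {ε : ℝ} (hε : 0 < ε) :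
    ∃ r, 0 < r ∧ r < ε ∧ ∀ l (n N : ℕ), r * ‖q‖ ^ N ≠ ‖d l * q ^ n‖ := by
  have hcount : (Set.range fun i : Fin D × ℕ × ℕ =>
      ‖d i.1 * q ^ i.2.1‖ / ‖q‖ ^ i.2.2).Countable := Set.countable_range _
  obtain ⟨r, hr, h1, h2⟩ := (hcount.dense_compl ℝ).exists_between hε
  refine ⟨r, h1, h2, fun l n N h => hr ⟨(l, n, N), ?_⟩⟩
  have : ‖q‖ ^ N ≠ 0 := pow_ne_zero _ (norm_ne_zero_iff.2 hq0)
  simp only [← h]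
  field_simp

theorem exists_lt_iff_lt_norm_mul_pow (hq : ‖q‖ < 1) {x : ℂ} {r : ℝ} (hr : 0 < r)
    (hne : ∀ n : ℕ, r ≠ ‖x * q ^ n‖) :
    ∃ M : ℕ, (∀ n < M, r < ‖x * q ^ n‖) ∧ ∀ n, M ≤ n → ‖x * q ^ n‖ < r := by
  classical
  have hlim : Tendsto (fun n : ℕ => ‖x * q ^ n‖) atTop (𝓝 0) := by
    simpa using ((tendsto_pow_atTop_nhds_zero_of_norm_lt_one hq).const_mul x).norm
  have hanti : Antitone fun n : ℕ => ‖x * q ^ n‖ := fun i j hij => by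
    simp only [norm_mul, norm_pow]
    exact mul_le_mul_of_nonneg_left (pow_le_pow_of_le_one (norm_nonneg _) hq.le hij)
      (norm_nonneg _)
  have hex : ∃ n : ℕ, ‖x * q ^ n‖ < r := (hlim.eventually_lt_const hr).exists
  refine ⟨Nat.find hex, fun n hn => lt_of_le_of_ne (not_lt.1 (Nat.find_min hex hn)) (hne n),
    fun n hn => (hanti hn).trans_lt (Nat.find_spec hex)⟩

/-- The sum of the residues of the kernel inside the circle of radius `R`. -/
theorem circleIntegral_kernel_eq_tsum (hq0 : q ≠ 0) (hq : ‖q‖ < 1) (m : ℤ)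
    (hd0 : ∀ l, d l ≠ 0) (hdd : ∀ l l', l ≠ l' → d l / d l' ∉ Omega q) {R : ℝ}
    (hR : 0 < R) (hc : ∀ k, ‖t * c k‖ * R < 1) (hd : ∀ l, ‖d l‖ < R)
    (h : B < D ∨ (B = D ∧ ‖q ^ m * ∏ j, b j‖ < ‖∏ l, d l‖))
    (hs : ∀ k, Summable fun n => residueKernel m t a b c d q k n (d k * q ^ n)) :
    (∮ w in C(0, R), kernel m t a b c d q w / w) = 2 * Real.pi * Complex.I *
        ∑ k, ∑' n, residueKernel m t a b c d q k n (d k * q ^ n) := by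
  have hq' : 0 < ‖q‖ := norm_pos_iff.2 hq0
  obtain ⟨δ, hδ, ρ, hρ0, hρ1, hdecay⟩ :=
    exists_norm_kernel_mul_le (t := t) (a := a) (c := c) hq0 hq m hd0 h
  obtain ⟨r, hr, hrε, hgen⟩ := exists_radius_ne hq0 d (lt_min hδ hR)
  have hrN (N : ℕ) : 0 < r * ‖q‖ ^ N := by positivity
  choose M hM hM' using fun (N : ℕ) (l : Fin D) =>
    exists_lt_iff_lt_norm_mul_pow hq (hrN N) fun n => hgen l n N
  have hlim := tendsto_circleIntegral_kernel hq0 m hq hρ0 hρ1 hdecay hr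
    (hrε.trans_le (min_le_left _ _)) fun w hw => by
      rw [mem_sphere_zero_iff_norm] at hw
      have hw0 : w ≠ 0 := norm_pos_iff.1 (hw ▸ hr)
      refine (differentiableAt_kernel hq m hw0 ?_ fun i =>
        notMem_Omega_of_norm_lt_one hq0 hq ?_).continuousAt.continuousWithinAt
      · rintro l ⟨n, hn⟩
        refine hgen l n 0 ?_
        rw [pow_zero, mul_one, ← hw, ← eq_mul_pow_of_div_mem_Omega hq0 hw0 hn]
      · rw [norm_mul, hw]
        exact (mul_le_mul_of_nonneg_left (hrε.trans_le (min_le_right _ _)).le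
          (norm_nonneg _)).trans_lt (hc i)
  have hMlim (l : Fin D) : Tendsto (fun N => M N l) atTop atTop := by
    refine tendsto_atTop.2 fun K => ?_
    have h0 : Tendsto (fun N : ℕ => r * ‖q‖ ^ N) atTop (𝓝 0) := by
      simpa using (tendsto_pow_atTop_nhds_zero_of_lt_one hq'.le hq).const_mul r
    have hK : 0 < ‖d l * q ^ K‖ := norm_pos_iff.2 (mul_ne_zero (hd0 l) (pow_ne_zero _ hq0))
    filter_upwards [h0.eventually_lt_const hK] with N hN
    by_contra! hlt
    exact absurd (hM' N l K hlt.le) (not_lt.2 hN.le)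
  have hsum : Tendsto (fun N => ∑ k, ∑ n ∈ Finset.range (M N k),
      residueKernel m t a b c d q k n (d k * q ^ n)) atTop
      (𝓝 (∑ k, ∑' n, residueKernel m t a b c d q k n (d k * q ^ n))) :=
    tendsto_finsetSum _ fun k _ => (hs k).hasSum.tendsto_sum_nat.comp (hMlim k)
  have htot := hlim.add (hsum.const_mul (2 * Real.pi * Complex.I))
  rw [zero_add] at htot
  -- The outer integral does not depend on `N`, so it equals the limit of the inner integrals plus
  -- the partial residue sums.
  refine tendsto_nhds_unique (tendsto_const_nhds.congr fun N => ?_) htot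
  refine circleIntegral_kernel_eq_add_sum hq0 hq m hd0 hdd (hrN N) ?_ hc hd (M N) (hM N) (hM' N)
  exact (mul_le_of_le_one_right hr.le (pow_le_one₀ hq'.le hq.le)).trans_lt
    (hrε.trans_le (min_le_right _ _))

theorem summable_vdBRTerm_arg (hq0 : q ≠ 0) (hq : ‖q‖ < 1) (m : ℤ) (hd0 : ∀ l, d l ≠ 0)
    (hda : ∀ k i, t * d k * a i ∉ Omega q) (hdd : ∀ l l', l ≠ l' → d l / d l' ∉ Omega q)
    (h : B < D ∨ (B = D ∧ ‖q ^ m * ∏ j, b j‖ < ‖∏ l, d l‖)) (k : Fin D) :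
    Summable (vdBRTerm ((C : ℤ) - A) (topPar t b c d q k) (botPar t a d q k) q
      (arg m b d q k)) := by
  refine summable_vdBRTerm hq0 hq (notMem_Omega_of_mem_botPar hq0 hd0 k hda hdd) ?_
  rw [card_botPar_sub_card_topPar]
  refine h.imp (fun h => by lia) fun h => ⟨by lia, ?_⟩
  rw [norm_arg_of_eq h.1, div_lt_one (norm_pos_iff.2 (Finset.prod_ne_zero_iff.2 fun l _ => hd0 l))]
  exact h.2

theorem sqrt_zpow (t : ℂ) (m : ℤ) : Complex.sqrt t ^ m = t ^ ((m : ℂ) / 2) := by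
  rw [Complex.sqrt, ← Complex.cpow_mul_int, div_eq_mul_inv, mul_comm]

/-- The expansion of `G` over the poles `d k * q ^ n`, with the convergence behaviour of the
series. -/
theorem G_expansion (hq0 : q ≠ 0) (hq : ‖q‖ < 1) (m : ℤ) (ht : t ≠ 0) {σ : ℝ} (hσ : 0 < σ)
    (hc : ∀ k, ‖c k‖ < σ / ‖t‖) (hd : ∀ l, ‖d l‖ < 1 / σ)
    (hd0 : ∀ l, d l ≠ 0) (hb0 : ∀ j, b j ≠ 0) (hda : ∀ k i, t * d k * a i ∉ Omega q)
    (hdd : ∀ l l', l ≠ l' → d l / d l' ∉ Omega q) :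
    ((B < D ∨ (B = D ∧ ‖q ^ m * ∏ j, b j‖ < ‖∏ l, d l‖)) →
      G m t a b c d σ q = t ^ ((m : ℂ) / 2) * ∑ k : Fin D, coeff m t a b c d q k *
        vdBR ((C : ℤ) - A) (topPar t b c d q k) (botPar t a d q k) q (arg m b d q k)) ∧
    (B < D → ∀ k : Fin D,
      (∀ z : ℂ, Summable
        (vdBRTerm ((C : ℤ) - A) (topPar t b c d q k) (botPar t a d q k) q z)) ∧
      Differentiable ℂ
        (fun z => vdBR ((C : ℤ) - A) (topPar t b c d q k) (botPar t a d q k) q z)) ∧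
    (B = D → ‖q ^ m * ∏ j, b j‖ < ‖∏ l, d l‖ → ∀ k : Fin D, Summable
      (vdBRTerm ((C : ℤ) - A) (topPar t b c d q k) (botPar t a d q k) q (arg m b d q k))) ∧
    ((D < B ∨ (B = D ∧ ‖∏ l, d l‖ ≤ ‖q ^ m * ∏ j, b j‖)) → ∀ k : Fin D,
      (∀ x ∈ topPar t b c d q k, x ∉ Omega q) → SeriesDiverges
      (vdBRTerm ((C : ℤ) - A) (topPar t b c d q k) (botPar t a d q k) q (arg m b d q k))) := by
  have ht' := norm_pos_iff.2 ht
  have hprod : 0 < ‖∏ l, d l‖ := norm_pos_iff.2 (Finset.prod_ne_zero_iff.2 fun l _ => hd0 l)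
  have hc' (k : Fin C) : ‖t * c k‖ * (1 / σ) < 1 := by
    have h := hc k
    rw [lt_div_iff₀ ht'] at h
    rw [norm_mul, mul_one_div, div_lt_one hσ, mul_comm]
    exact h
  -- Here `|t c_i d_k| < 1` follows from the two radius bounds, so no separate nonvanishing
  -- assumption is needed.
  have hdc (k : Fin D) (i : Fin C) : t * d k * c i ∉ Omega q := by
    refine notMem_Omega_of_norm_lt_one hq0 hq ?_
    rw [mul_right_comm, norm_mul]
    exact (mul_le_mul_of_nonneg_left (hd k).le (norm_nonneg _)).trans_lt (hc' i)
  have hP : qPochInf q q ≠ 0 := qPochInf_ne_zero hq (notMem_Omega_of_norm_lt_one hq0 hq hq)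
  refine ⟨fun h => ?_, fun h k => ?_, fun h h' k => ?_, fun h k htop => ?_⟩
  · have hterm (k : Fin D) (n : ℕ) : residueKernel m t a b c d q k n (d k * q ^ n) =
        (qPochInf q q)⁻¹ * (coeff m t a b c d q k * vdBRTerm ((C : ℤ) - A) (topPar t b c d q k)
          (botPar t a d q k) q (arg m b d q k) n) := by
      rw [← qPochInf_mul_residueKernel hq0 hq m hd0 hb0 hda hdc, inv_mul_cancel_left₀ hP]
    have hsum (k : Fin D) := summable_vdBRTerm_arg (c := c) hq0 hq m hd0 hda hdd h k
    have hpi : (2 * Real.pi * Complex.I : ℂ) ≠ 0 := Complex.two_pi_I_ne_zero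
    rw [G_eq_circleIntegral hσ, circleIntegral_kernel_eq_tsum hq0 hq m hd0 hdd (by positivity) hc'
      hd h fun k => by simpa only [hterm] using ((hsum k).mul_left _).mul_left _,
      inv_mul_cancel_left₀ hpi, ← sqrt_zpow]
    simp only [hterm, tsum_mul_left, ← Finset.mul_sum, vdBR]
    field_simp
  · have hs (z : ℂ) : Summable
        (vdBRTerm ((C : ℤ) - A) (topPar t b c d q k) (botPar t a d q k) q z) := by
      refine summable_vdBRTerm hq0 hq (notMem_Omega_of_mem_botPar hq0 hd0 k hda hdd) (Or.inl ?_)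
      rw [card_botPar_sub_card_topPar]
      lia
    exact ⟨hs, differentiable_vdBR hs⟩
  · exact summable_vdBRTerm_arg hq0 hq m hd0 hda hdd (Or.inr ⟨h, h'⟩) k
  · refine seriesDiverges_vdBRTerm hq0 hq htop (notMem_Omega_of_mem_botPar hq0 hd0 k hda hdd)
      (arg_ne_zero hq0 hd0 hb0 m k) ?_
    rw [card_botPar_sub_card_topPar]
    refine h.imp (fun h => by lia) fun h => ⟨by lia, ?_⟩
    rw [norm_arg_of_eq h.1, one_le_div hprod]
    exact h.2

end QSeries

end

/-! ### The main theorem -/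

open QSeries in
theorem mainTheorem1 {A B C D : ℕ} (q : ℂ) (hq0 : q ≠ 0) (hq1 : ‖q‖ < 1) (m : ℤ)
    (t : ℂ) (ht : t ≠ 0) (σ : ℝ) (hσ : 0 < σ)
    (a : Fin A → ℂ) (b : Fin B → ℂ) (c : Fin C → ℂ) (d : Fin D → ℂ)
    (hc : ∀ k, ‖c k‖ < σ / ‖t‖) (hd : ∀ l, ‖d l‖ < 1 / σ) :
    -- the integral exists
    IntervalIntegrable (integrand m t a b c d σ q) MeasureTheory.volume (-Real.pi) Real.pi ∧
    -- reflection symmetry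
    ((∀ k, ‖c k‖ < min (1 / σ) (σ / ‖t‖)) → (∀ l, ‖d l‖ < min (1 / σ) (σ / ‖t‖)) →
      G m t a b c d σ q = G (-m) t b a d c σ q) ∧
    -- the expansion over the poles `d_k`, with the convergence behaviour of its series
    ((∀ l, d l ≠ 0) → (∀ j, b j ≠ 0) → (∀ k i, t * d k * a i ∉ Omega q) →
      (∀ l l', l ≠ l' → d l / d l' ∉ Omega q) →
      ((B < D ∨ (B = D ∧ ‖q ^ m * ∏ j, b j‖ < ‖∏ l, d l‖)) →
        G m t a b c d σ q = t ^ ((m : ℂ) / 2) * ∑ k : Fin D, coeff m t a b c d q k *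
          vdBR ((C : ℤ) - A) (topPar t b c d q k) (botPar t a d q k) q (arg m b d q k)) ∧
      (B < D → ∀ k : Fin D,
        (∀ z : ℂ, Summable
          (vdBRTerm ((C : ℤ) - A) (topPar t b c d q k) (botPar t a d q k) q z)) ∧
        Differentiable ℂ
          (fun z => vdBR ((C : ℤ) - A) (topPar t b c d q k) (botPar t a d q k) q z)) ∧
      (B = D → ‖q ^ m * ∏ j, b j‖ < ‖∏ l, d l‖ → ∀ k : Fin D, Summable
        (vdBRTerm ((C : ℤ) - A) (topPar t b c d q k) (botPar t a d q k) q (arg m b d q k))) ∧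
      ((D < B ∨ (B = D ∧ ‖∏ l, d l‖ ≤ ‖q ^ m * ∏ j, b j‖)) → ∀ k : Fin D,
        (∀ x ∈ topPar t b c d q k, x ∉ Omega q) → SeriesDiverges
        (vdBRTerm ((C : ℤ) - A) (topPar t b c d q k) (botPar t a d q k) q (arg m b d q k)))) ∧
    -- the expansion over the poles `c_k`, with the convergence behaviour of its series
    ((∀ k, c k ≠ 0) → (∀ i, a i ≠ 0) → (∀ k j, t * c k * b j ∉ Omega q) →
      (∀ k k', k ≠ k' → c k / c k' ∉ Omega q) →
      ((A < C ∨ (A = C ∧ ‖q ^ (-m) * ∏ i, a i‖ < ‖∏ k, c k‖)) →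
        G m t a b c d σ q = 1 / t ^ ((m : ℂ) / 2) * ∑ k : Fin C, coeff (-m) t b a d c q k *
          vdBR ((D : ℤ) - B) (topPar t a d c q k) (botPar t b c q k) q (arg (-m) a c q k)) ∧
      (A < C → ∀ k : Fin C,
        (∀ z : ℂ, Summable
          (vdBRTerm ((D : ℤ) - B) (topPar t a d c q k) (botPar t b c q k) q z)) ∧
        Differentiable ℂ
          (fun z => vdBR ((D : ℤ) - B) (topPar t a d c q k) (botPar t b c q k) q z)) ∧
      (A = C → ‖q ^ (-m) * ∏ i, a i‖ < ‖∏ k, c k‖ → ∀ k : Fin C, Summable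
        (vdBRTerm ((D : ℤ) - B) (topPar t a d c q k) (botPar t b c q k) q (arg (-m) a c q k))) ∧
      ((C < A ∨ (A = C ∧ ‖∏ k, c k‖ ≤ ‖q ^ (-m) * ∏ i, a i‖)) → ∀ k : Fin C,
        (∀ x ∈ topPar t a d c q k, x ∉ Omega q) → SeriesDiverges
        (vdBRTerm ((D : ℤ) - B) (topPar t a d c q k) (botPar t b c q k) q
          (arg (-m) a c q k)))) := by
  have ht' := norm_pos_iff.2 ht
  refine ⟨intervalIntegrable_integrand hq0 hq1 m ht hσ hc hd,
    G_reflection hq0 hq1 m ht hσ, G_expansion hq0 hq1 m ht hσ hc hd, fun hc0 ha0 hcb hcc => ?_⟩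
  -- At radius parameter `‖t‖/σ` the swapped bounds are exactly `hd` and `hc`, so (iii) does not
  -- require the stronger bounds of (i).
  have h := G_expansion (t := t) (σ := ‖t‖ / σ) hq0 hq1 (-m) ht (by positivity)
    (fun l => (hd l).trans_eq (by field_simp)) (fun k => (hc k).trans_eq (by field_simp))
    hc0 ha0 hcb hcc
  refine ⟨fun hAC => ?_, h.2⟩
  rw [G_eq_G_neg ht hσ, h.1 hAC, Int.cast_neg, neg_div, Complex.cpow_neg, one_div]
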